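/- Let $d\ge 1$ and let $\mathbb{R}^d=\Omega_i\sqcup S\sqcup\Omega_o$, where $S$ is an embedded $C^\infty$ hypersurface and $\Omega_i,\Omega_o$ are disjoint open sets. Let $\nu$ be the (continuous) unit normal field on $S$ pointing from $\Omega_i$ to $\Omega_o$, i.e. for every $x\in S$ one has $x-t\nu(x)\in\Omega_i$ and $x+t\nu(x)\in\Omega_o$ for all sufficiently small $t>0$. Let $\sigma$ be the surface measure on $S$ (the Euclidean-normalised $(d-1)$-dimensional Hausdorff measure), and write $\partial_\nu u=\nabla u\cdot\nu$. Let $\phi_i\in H^2_{\mathrm{loc}}(\Omega_i)$ and $\phi_o\in H^2_{\mathrm{loc}}(\Omega_o)$ satisfy $\Delta\phi_i=0$ in $\mathcal D'(\Omega_i)$ and $\Delta\phi_o=0$ in $\mathcal D'(\Omega_o)$, and let $\phi$ be the function on $\mathbb{R}^d$ equal to $\phi_i$ on $\Omega_i$ and to $\phi_o$ on $\Omega_o$. Assume that $\phi_i$ and $\phi_o$ have traces $\gamma_i\phi,\gamma_o\phi\in L^1_{\mathrm{loc}}(S)$ and normal traces $\partial_\nu\phi_i|_S,\partial_\nu\phi_o|_S\in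 L^1_{\mathrm{loc}}(S)$ in the following sense, where $\Omega\in\{\Omega_i,\Omega_o\}$ and $u$ is the corresponding function. * $g$ is the trace of $u$ on $S$ if $u$ has a weak gradient on $\Omega$ and there are $w_n\in C^\infty(\mathbb{R}^d)$ with $w_n\to u$ and $\nabla w_n\to\nabla u$ in $L^1(\Omega\cap K)$ and $w_n|_S\to g$ in $L^1(S\cap K)$ for every compact $K\subset\mathbb{R}^d$. * $h$ is the normal trace $\partial_\nu u|_S$ if $u$ has a weak gradient on $\Omega$, this gradient has a weak divergence $\Delta u$ that is a locally integrable function on $\Omega$, and there are $F_n\in C^\infty(\mathbb{R}^d;\mathbb{R}^d)$ with $F_n\to\nabla u$ and $\operatorname{div}F_n\to\Delta u$ in $L^1(\Omega\cap K)$ and $F_n\cdot\nu\to h$ in $L^1(S\cap K)$ for every compact $K\subset\mathbb{R}^d$. (If $u\in H^2(\Omega\cap B_R)$ for every $R>0$, both exist and are the usual Sobolev traces of $u$ and of $\nabla u\cdot\nu$.) Define the jumps $$[\phi]_S:=\gamma_o\phi-\gamma_i\phi,\qquad [\partial_\nu\phi]_S:=\partial_\nu\phi_o|_S-\partial_\nu\phi_i|_S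 .$$ Then $\phi\in L^1_{\mathrm{loc}}(\mathbb{R}^d)$, and for every $\psi\in C_c^\infty(\mathbb{R}^d)$ $$\langle\Delta\phi,\psi\rangle=\int_S[\partial_\nu\phi]_S\,\psi\,d\sigma-\int_S[\phi]_S\,\partial_\nu\psi\,d\sigma .$$ Equivalently, in $\mathcal D'(\mathbb{R}^d)$, $$\Delta\phi=[\partial_\nu\phi]_S\,\delta_S+[\phi]_S\,\partial_\nu\delta_S,$$ where $\langle f\,\delta_S,\psi\rangle:=\int_S f\,\psi\,d\sigma$ and $\langle f\,\partial_\nu\delta_S,\psi\rangle:=-\int_S f\,\partial_\nu\psi\,d\sigma$ for $f\in L^1_{\mathrm{loc}}(S)$. In particular, $\phi$ is a harmonic function on $\mathbb{R}^d$ (i.e. agrees almost everywhere with a classical harmonic function on $\mathbb{R}^d$) if and only if $[\phi]_S=0$ and $[\partial_\nu\phi]_S=0$ $\sigma$-almost everywhere on $S$. -/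

import Mathlib

open MeasureTheory Set Filter Topology TopologicalSpace
open scoped ContDiff Gradient Distributions LineDeriv ENNReal

noncomputable section

namespace Interface

/-- Euclidean space `ℝ^d`. -/
abbrev Euc (d : ℕ) : Type := EuclideanSpace ℝ (Fin d)

/-- The `j`-th standard basis vector of `ℝ^d`. -/
def stdVec {d : ℕ} (j : Fin d) : Euc d := EuclideanSpace.single j 1

/-! ### Hypersurfaces -/

/-- `ρ` is a smooth defining function of the set `S` near the point `x`: near `x`, the set `S` is
the zero set of `ρ`, and the gradient of `ρ` does not vanish at `x`. -/
structure IsLocalDefiningFunction {d : ℕ} (S : Set (Euc d)) (x : Euc d) (ρ : Euc d → ℝ) :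
    Prop where
  contDiff : ContDiff ℝ ∞ ρ
  gradient_ne_zero : ∇ ρ x ≠ 0
  mem_iff : ∀ᶠ y in 𝓝 x, (y ∈ S ↔ ρ y = 0)

/-- `S` is an embedded `C^∞` hypersurface of `ℝ^d`. -/
def IsSmoothHypersurface {d : ℕ} (S : Set (Euc d)) : Prop :=
  ∀ x ∈ S, ∃ ρ : Euc d → ℝ, IsLocalDefiningFunction S x ρ

/-- `n` is one of the two unit normal vectors of the hypersurface `S` at `x`. The other one is
obtained by replacing `ρ` by `-ρ`. -/
def IsUnitNormalAt {d : ℕ} (S : Set (Euc d)) (x n : Euc d) : Prop :=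
  ∃ ρ : Euc d → ℝ, IsLocalDefiningFunction S x ρ ∧ n = ‖∇ ρ x‖⁻¹ • ∇ ρ x

/-- `ℝ^d` is the disjoint union of the open set `Ωi`, the embedded smooth hypersurface `S` and the
open set `Ωo`, and `ν` is the unit normal field on `S` that points from `Ωi` to `Ωo`. -/
structure IsInterface {d : ℕ} (Ωi : Opens (Euc d)) (S : Set (Euc d)) (Ωo : Opens (Euc d))
    (ν : Euc d → Euc d) : Prop where
  hypersurface : IsSmoothHypersurface S
  cover : (Ωi : Set (Euc d)) ∪ S ∪ Ωo = univ
  disjoint_left : Disjoint (Ωi : Set (Euc d)) S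
  disjoint_right : Disjoint S (Ωo : Set (Euc d))
  disjoint_sides : Disjoint (Ωi : Set (Euc d)) (Ωo : Set (Euc d))
  normal_continuousOn : ContinuousOn ν S
  normal : ∀ x ∈ S, IsUnitNormalAt S x (ν x)
  points_inside : ∀ x ∈ S, ∀ᶠ t : ℝ in 𝓝[>] 0, x - t • ν x ∈ Ωi
  points_outside : ∀ x ∈ S, ∀ᶠ t : ℝ in 𝓝[>] 0, x + t • ν x ∈ Ωo

/-- The surface measure `dσ` on `S`: the `(d-1)`-dimensional Hausdorff measure on `S`, normalised
so that it agrees with Lebesgue measure on `ℝ^(d-1)`. -/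
def surfaceMeasure {d : ℕ} (S : Set (Euc d)) : Measure (Euc d) :=
  (Measure.euclideanHausdorffMeasure (d - 1) : Measure (Euc d)).restrict S

/-! ### Distributions, weak derivatives and Sobolev spaces -/

/-- The distribution on `Ω` with density `u` with respect to a measure `μ`, that is,
`ψ ↦ ∫ ψ u dμ`. (It is the zero distribution if `u` is not locally integrable on `Ω`.) -/
def distOfDensity {d : ℕ} (Ω : Opens (Euc d)) (μ : Measure (Euc d)) (u : Euc d → ℝ) :
    𝓓'(Ω, ℝ) :=
  TestFunction.integralAgainstBilinCLM (ContinuousLinearMap.mul ℝ ℝ) μ u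

/-- The distribution on `Ω` given by a locally integrable function `u`. -/
def distOfFun {d : ℕ} (Ω : Opens (Euc d)) (u : Euc d → ℝ) : 𝓓'(Ω, ℝ) :=
  distOfDensity Ω volume u

/-- The Laplacian `∑ⱼ ∂ⱼ ∂ⱼ T` of a distribution `T`. -/
def distLaplacian {d : ℕ} {Ω : Opens (Euc d)} (T : 𝓓'(Ω, ℝ)) : 𝓓'(Ω, ℝ) :=
  ∑ j : Fin d, ∂_{stdVec j} (∂_{stdVec j} T)

/-- `g` is the weak derivative on `Ω` of `u` in the direction `v`. -/
def HasWeakDeriv {d : ℕ} (Ω : Opens (Euc d)) (v : Euc d) (u g : Euc d → ℝ) : Prop :=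
  LocallyIntegrableOn u Ω ∧ LocallyIntegrableOn g Ω ∧
    ∂_{v} (distOfFun Ω u) = distOfFun Ω g

/-- `G` is the weak gradient of `u` on `Ω`. -/
def HasWeakGradient {d : ℕ} (Ω : Opens (Euc d)) (u : Euc d → ℝ) (G : Euc d → Euc d) : Prop :=
  LocallyIntegrableOn u Ω ∧ ∀ j : Fin d, HasWeakDeriv Ω (stdVec j) u (fun x => G x j)

/-- `D` is the weak divergence of the vector field `G` on `Ω`. -/
def HasWeakDivergence {d : ℕ} (Ω : Opens (Euc d)) (G : Euc d → Euc d) (D : Euc d → ℝ) : Prop :=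
  (∀ j : Fin d, LocallyIntegrableOn (fun x => G x j) Ω) ∧ LocallyIntegrableOn D Ω ∧
    ∑ j : Fin d, ∂_{stdVec j} (distOfFun Ω (fun x => G x j)) = distOfFun Ω D

/-- The space `H^k_loc(Ω)`: all weak derivatives of order at most `k` are square integrable on
the compact subsets of `Ω`. -/
def MemHloc {d : ℕ} (Ω : Opens (Euc d)) : ℕ → (Euc d → ℝ) → Prop
  | 0, u => ∀ K : Set (Euc d), IsCompact K → K ⊆ Ω → MemLp u 2 (volume.restrict K)
  | k + 1, u => (∀ K : Set (Euc d), IsCompact K → K ⊆ Ω → MemLp u 2 (volume.restrict K)) ∧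
      ∀ j : Fin d, ∃ g : Euc d → ℝ, HasWeakDeriv Ω (stdVec j) u g ∧ MemHloc Ω k g

/-! ### Traces -/

/-- The divergence of a differentiable vector field. -/
def divergence {d : ℕ} (F : Euc d → Euc d) (x : Euc d) : ℝ :=
  ∑ j : Fin d, fderiv ℝ F x (stdVec j) j

/-- `g` is the Sobolev trace on `S` of the function `u` on `Ω`. The trace is the continuous
extension of the restriction `w ↦ w|_S` from functions that are smooth up to the boundary:
`u` is the limit, in `W^{1,1}` on the bounded parts of `Ω`, of smooth functions `w n` whose
restrictions to `S` converge to `g` in `L^1` on the bounded parts of `S`. For functions that are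
`H^1` on the bounded parts of `Ω` this is their usual `H^1` trace. -/
def HasTrace {d : ℕ} (Ω : Opens (Euc d)) (S : Set (Euc d)) (u g : Euc d → ℝ) : Prop :=
  LocallyIntegrable g (surfaceMeasure S) ∧
  ∃ G : Euc d → Euc d, HasWeakGradient Ω u G ∧
  ∃ w : ℕ → Euc d → ℝ, (∀ n, ContDiff ℝ ∞ (w n)) ∧
    ∀ K : Set (Euc d), IsCompact K →
      Tendsto (fun n => ∫⁻ x in Ω ∩ K, ‖w n x - u x‖ₑ) atTop (𝓝 0) ∧
      Tendsto (fun n => ∫⁻ x in Ω ∩ K, ‖∇ (w n) x - G x‖ₑ) atTop (𝓝 0) ∧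
      Tendsto (fun n => ∫⁻ x in K, ‖w n x - g x‖ₑ ∂(surfaceMeasure S)) atTop (𝓝 0)

/-- `h` is the normal trace `∂_ν u` on `S` of the function `u` on `Ω`, where `ν` is a unit normal
field on `S`. It is the normal component on `S` of the gradient field of `u`, obtained as the
continuous extension of `F ↦ F · ν` from fields that are smooth up to the boundary: `∇u` is the
limit, together with its divergence `Δu`, in `L^1` on the bounded parts of `Ω`, of smooth fields
`F n` whose normal components converge to `h` in `L^1` on the bounded parts of `S`. For functions
that are `H^2` on the bounded parts of `Ω` this is `ν · γ(∇u)`, with `γ` the Sobolev trace. -/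
def HasNormalTrace {d : ℕ} (Ω : Opens (Euc d)) (S : Set (Euc d)) (ν : Euc d → Euc d)
    (u h : Euc d → ℝ) : Prop :=
  LocallyIntegrable h (surfaceMeasure S) ∧
  ∃ (G : Euc d → Euc d) (D : Euc d → ℝ), HasWeakGradient Ω u G ∧ HasWeakDivergence Ω G D ∧
  ∃ F : ℕ → Euc d → Euc d, (∀ n, ContDiff ℝ ∞ (F n)) ∧
    ∀ K : Set (Euc d), IsCompact K →
      Tendsto (fun n => ∫⁻ x in Ω ∩ K, ‖F n x - G x‖ₑ) atTop (𝓝 0) ∧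
      Tendsto (fun n => ∫⁻ x in Ω ∩ K, ‖divergence (F n) x - D x‖ₑ) atTop (𝓝 0) ∧
      Tendsto (fun n => ∫⁻ x in K, ‖inner ℝ (F n x) (ν x) - h x‖ₑ ∂(surfaceMeasure S))
        atTop (𝓝 0)

/-- The jump `outer value - inner value` across the interface. -/
def jump {d : ℕ} (inner outer : Euc d → ℝ) : Euc d → ℝ := fun x => outer x - inner x

open Classical in
/-- The function on `ℝ^d` that is `φi` on `Ωi` and `φo` on `Ωo`. (The value `0` on the remaining
set, which will be the null set `S`, is irrelevant.) -/
def glue {d : ℕ} (Ωi Ωo : Opens (Euc d)) (φi φo : Euc d → ℝ) : Euc d → ℝ :=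
  fun x => if x ∈ Ωi then φi x else if x ∈ Ωo then φo x else 0

/-! ### Layers -/

/-- The single layer `f δ_S`: the distribution `ψ ↦ ∫_S f ψ dσ`. -/
def singleLayer {d : ℕ} (S : Set (Euc d)) (f : Euc d → ℝ) : 𝓓'((⊤ : Opens (Euc d)), ℝ) :=
  distOfDensity ⊤ (surfaceMeasure S) f

/-- The double layer `f ∂_ν δ_S`: the distribution `ψ ↦ -∫_S f ∂_νψ dσ`. As `⟨∂ⱼ T, ψ⟩ = -⟨T, ∂ⱼψ⟩`,
this is `∑ⱼ ∂ⱼ (f νⱼ δ_S)`. -/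
def doubleLayer {d : ℕ} (S : Set (Euc d)) (ν : Euc d → Euc d) (f : Euc d → ℝ) :
    𝓓'((⊤ : Opens (Euc d)), ℝ) :=
  ∑ j : Fin d, ∂_{stdVec j} (singleLayer S (fun x => f x * ν x j))

/-- `u` is (almost everywhere equal to) a classical harmonic function on all of `ℝ^d`. -/
def IsGloballyHarmonic {d : ℕ} (u : Euc d → ℝ) : Prop :=
  ∃ H : Euc d → ℝ, InnerProductSpace.HarmonicOnNhd H univ ∧ u =ᵐ[volume] H

end Interface

end

/-! The jump formula is Green's second identity on the two sides of `S`, added up. The sides lie on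
opposite sides of `ν`, so the boundary terms enter with opposite signs and only the jumps remain.

The traces are limits of restrictions of smooth functions and fields, so Green's identity
(`integral_mul_laplacian_of_hasTrace`) follows by passing to the limit in the divergence theorem for
smooth, compactly supported fields, `IsInterface.setIntegral_inside_fderiv`. This is proved for
fields `ψ v` with `v` constant. Near a point of `S`, in a direction `e` that crosses `S`, the inside
is the region below a graph (`IsInterface.exists_graphBox`), and the fundamental theorem of calculus
along the lines in direction `e` leaves an integral of `ψ` over the graph with respect to Lebesgue
measure on the base. A general `v` is a difference of two such directions, and a partition of unity
makes the statement global.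

The link to the Hausdorff measure on `S` is the area formula `Frame.map_graph_volume`: Lebesgue
measure on the base is the surface measure weighted by `⟪ν, e⟫`. Locally, `S` is carried to its
tangent hyperplane, along `e`, by a map whose bilipschitz constant is as close to `1` as desired,
and on a hyperplane the factor is the determinant computed in `Frame.normDet_tilt`.

For the last equivalence, if both jumps vanish, then the glued function is weakly harmonic, and
Weyl's lemma (`isGloballyHarmonic_of_integral_laplacian_eq_zero`) makes it harmonic: its means
against rescaled radial mollifiers do not depend on the scale, because the derivative of the
mollifier in the scale is the Laplacian of a test function. Conversely, if the glued function is
harmonic, the single and the double layer cancel. Test functions `ρ χ`, where `ρ` is a defining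
function of `S`, vanish on `S` and have arbitrary normal derivatives there, which isolates the
double layer (`IsInterface.ae_eq_zero_of_layers`). -/

namespace Interface

/-! ### Comparison of measures -/

/-- A bound `μ ≤ c ν` on the measurable subsets of `T` that holds near each point of `T` holds
globally: a countable cover by such neighbourhoods is made disjoint. -/
theorem measure_le_mul_of_locally {X : Type*} [TopologicalSpace X] [SecondCountableTopology X]
    [MeasurableSpace X] [OpensMeasurableSpace X] {μ ν : Measure X} {T : Set X} {c : ℝ≥0∞}
    (h : ∀ x ∈ T, ∃ N ∈ 𝓝 x, ∀ A ⊆ T ∩ N, MeasurableSet A → μ A ≤ c * ν A)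
    {A : Set X} (hA : A ⊆ T) (hAm : MeasurableSet A) : μ A ≤ c * ν A := by
  choose! N hN hNA using h
  obtain ⟨s, hsA, hs, hcov⟩ := TopologicalSpace.countable_cover_nhdsWithin
    (s := A) (f := fun x => interior (N x)) fun x hx =>
      mem_nhdsWithin_of_mem_nhds (interior_mem_nhds.2 (hN x (hA hx)))
  rcases s.eq_empty_or_nonempty with rfl | hne
  · have : A = ∅ := by simpa using hcov
    simp [this]
  obtain ⟨f, rfl⟩ := hs.exists_eq_range hne
  rw [biUnion_range] at hcov
  have hdm : ∀ k, MeasurableSet (A ∩ disjointed (fun k => interior (N (f k))) k) := fun k =>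
    hAm.inter (MeasurableSet.disjointed (fun k => isOpen_interior.measurableSet) k)
  have hdd : Pairwise (Function.onFun Disjoint
      fun k => A ∩ disjointed (fun k => interior (N (f k))) k) := fun i j hij =>
    (disjoint_disjointed _ hij).mono inter_subset_right inter_subset_right
  have hAe : A = ⋃ k, A ∩ disjointed (fun k => interior (N (f k))) k := by
    rw [← inter_iUnion, iUnion_disjointed, inter_eq_left.2 hcov]
  rw [hAe, measure_iUnion hdd hdm, measure_iUnion hdd hdm, ← ENNReal.tsum_mul_left]
  refine ENNReal.tsum_le_tsum fun k => ?_
  refine hNA (f k) (hA (hsA (mem_range_self k))) _ (fun x hx => ⟨hA hx.1, ?_⟩) (hdm k)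
  exact interior_subset (disjointed_subset (fun k => interior (N (f k))) k hx.2)

theorem _root_.LipschitzOnWith.euclideanHausdorffMeasure_image_le {X Y : Type*} [EMetricSpace X]
    [MeasurableSpace X] [BorelSpace X] [EMetricSpace Y] [MeasurableSpace Y] [BorelSpace Y]
    {K : NNReal} {f : X → Y} {s : Set X} (h : LipschitzOnWith K f s) (d : ℕ) :
    Measure.euclideanHausdorffMeasure d (f '' s) ≤
      (K : ℝ≥0∞) ^ d * Measure.euclideanHausdorffMeasure d s := by
  rw [Measure.euclideanHausdorffMeasure_def, Measure.euclideanHausdorffMeasure_def,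
    Measure.smul_apply, Measure.smul_apply, ENNReal.smul_def, ENNReal.smul_def, smul_eq_mul,
    smul_eq_mul, mul_left_comm]
  gcongr
  simpa using h.hausdorffMeasure_image_le (d := d) (by positivity)

/-! ### Orthonormal frames and the area formula for graphs -/

/-- Orthonormal coordinates of `ℝ^(n+1)` adapted to a unit vector `e`: the isometric inclusion
`incl` of `ℝ^n` onto the hyperplane `e^⊥`, and the orthogonal projection `proj` along `e`, read as a
map to `ℝ^n`. -/
structure Frame {n : ℕ} (e : Euc (n + 1)) where
  incl : Euc n →ₗᵢ[ℝ] Euc (n + 1)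
  proj : Euc (n + 1) →L[ℝ] Euc n
  norm_eq : ‖e‖ = 1
  inner_incl : ∀ u, inner ℝ e (incl u) = 0
  decomp : ∀ x, incl (proj x) + inner ℝ e x • e = x

theorem exists_frame {n : ℕ} {e : Euc (n + 1)} (he : ‖e‖ = 1) : Nonempty (Frame e) := by
  have he0 : e ≠ 0 := by intro h; simp [h] at he
  have hfr : Module.finrank ℝ (ℝ ∙ e)ᗮ = n := by
    have : Fact (Module.finrank ℝ (Euc (n + 1)) = n + 1) := ⟨by simp⟩
    exact Submodule.finrank_orthogonal_span_singleton he0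
  let b : (ℝ ∙ e)ᗮ ≃ₗᵢ[ℝ] Euc n :=
    ((stdOrthonormalBasis ℝ (ℝ ∙ e)ᗮ).reindex (finCongr hfr)).repr
  refine ⟨⟨(ℝ ∙ e)ᗮ.subtypeₗᵢ.comp b.symm.toLinearIsometry,
    (b.toLinearIsometry.toContinuousLinearMap).comp ((ℝ ∙ e)ᗮ).orthogonalProjectionOnto,
    he, ?_, ?_⟩⟩
  · intro u
    have := (b.symm u).2
    rw [Submodule.mem_orthogonal_singleton_iff_inner_right] at this
    simpa using this
  · intro x
    have h1 := Submodule.starProjection_add_starProjection_orthogonal (K := ℝ ∙ e) x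
    have h2 := Submodule.starProjection_unit_singleton ℝ he x
    rw [h2, add_comm (inner ℝ e x • e)] at h1
    simpa using h1

namespace Frame

variable {n : ℕ} {e : Euc (n + 1)} (fr : Frame e)
include fr

theorem inner_self : inner ℝ e e = 1 := by
  rw [real_inner_self_eq_norm_sq, fr.norm_eq]; norm_num

@[simp] theorem proj_incl (u : Euc n) : fr.proj (fr.incl u) = u := by
  have := fr.decomp (fr.incl u)
  rw [fr.inner_incl, zero_smul, add_zero] at this
  exact fr.incl.injective this

@[simp] theorem proj_normal : fr.proj e = 0 := by
  have := fr.decomp e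
  rw [fr.inner_self, one_smul] at this
  have h : fr.incl (fr.proj e) = 0 := by simpa using this
  exact fr.incl.injective (by rw [h, map_zero])

theorem proj_point (u : Euc n) (t : ℝ) : fr.proj (fr.incl u + t • e) = u := by simp

theorem inner_point (u : Euc n) (t : ℝ) : inner ℝ e (fr.incl u + t • e) = t := by
  simp [inner_add_right, fr.inner_incl, inner_smul_right, fr.norm_eq]

/-- The coordinates `(u, s) ↦ incl u + s e` are isometric for the `ℓ²` product. -/
theorem inner_point_point (u w : Euc n) (s t : ℝ) :
    inner ℝ (fr.incl u + s • e) (fr.incl w + t • e) = inner ℝ u w + s * t := by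
  simp [inner_add_right, inner_add_left, fr.inner_incl, inner_smul_right, inner_smul_left,
    fr.norm_eq, real_inner_comm e, mul_comm]

theorem inner_eq (x y : Euc (n + 1)) :
    inner ℝ x y = inner ℝ (fr.proj x) (fr.proj y) + inner ℝ e x * inner ℝ e y := by
  conv_lhs => rw [← fr.decomp x, ← fr.decomp y]
  rw [fr.inner_point_point]

theorem measurePreserving :
    MeasurePreserving (fun p : Euc n × ℝ => fr.incl p.1 + p.2 • e) := by
  let l : WithLp 2 (Euc n × ℝ) →ₗ[ℝ] Euc (n + 1) :=
    { toFun := fun p => fr.incl p.fst + p.snd • e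
      map_add' := fun p q => by simp [add_smul]; abel
      map_smul' := fun c p => by simp [mul_smul] }
  let li : WithLp 2 (Euc n × ℝ) →ₗᵢ[ℝ] Euc (n + 1) :=
    { l with
      norm_map' := fun p => by
        have h := fr.inner_point_point p.fst p.fst p.snd p.snd
        have h1 : ‖l p‖ ^ 2 = ‖p‖ ^ 2 := by
          rw [WithLp.prod_norm_sq_eq_of_L2, ← real_inner_self_eq_norm_sq,
            ← real_inner_self_eq_norm_sq p.fst]
          change inner ℝ (fr.incl p.fst + p.snd • e) (fr.incl p.fst + p.snd • e) = _
          rw [h, Real.norm_eq_abs, sq_abs, sq]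
        exact (sq_eq_sq₀ (norm_nonneg _) (norm_nonneg _)).1 h1 }
  have hrank : Module.finrank ℝ (WithLp 2 (Euc n × ℝ)) = Module.finrank ℝ (Euc (n + 1)) := by
    rw [LinearEquiv.finrank_eq (WithLp.linearEquiv 2 ℝ (Euc n × ℝ))]; simp
  have h1 := (li.toLinearIsometryEquiv hrank).measurePreserving
  exact h1.comp (WithLp.volume_preserving_toLp (Euc n) ℝ)

/-- The inverse of the projection along `e` from the hyperplane `ν₁^⊥` to `e^⊥ = ℝ^n`. The formula
uses `⟪ν₁, e⟫⁻¹`, so this reading requires `⟪ν₁, e⟫ ≠ 0`. -/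
noncomputable def tilt (ν₁ : Euc (n + 1)) : Euc n →ₗ[ℝ] Euc (n + 1) :=
  fr.incl.toLinearMap -
    ((inner ℝ ν₁ e)⁻¹ • ((innerₛₗ ℝ ν₁).comp fr.incl.toLinearMap)).smulRight e

theorem tilt_apply (ν₁ : Euc (n + 1)) (u : Euc n) :
    fr.tilt ν₁ u = fr.incl u - ((inner ℝ ν₁ e)⁻¹ * inner ℝ ν₁ (fr.incl u)) • e := by
  simp [tilt]

theorem tilt_proj {ν₁ : Euc (n + 1)} (hc : inner ℝ ν₁ e ≠ 0) (x : Euc (n + 1)) :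
    fr.tilt ν₁ (fr.proj x) = x - ((inner ℝ ν₁ e)⁻¹ * inner ℝ ν₁ x) • e := by
  have h : fr.incl (fr.proj x) = x - inner ℝ e x • e := by
    rw [eq_sub_iff_add_eq]; exact fr.decomp x
  rw [tilt_apply, h, inner_sub_right, inner_smul_right, mul_sub, sub_smul]
  have : (inner ℝ ν₁ e)⁻¹ * (inner ℝ e x * inner ℝ ν₁ e) = inner ℝ e x := by
    field_simp
  rw [this]; abel

/-- The linear map `tilt ν₁` multiplies `n`-dimensional volume by `1 / ⟪ν₁, e⟫`: the Gram operator
of `tilt ν₁` is the identity plus an operator of rank one, so its determinant is explicit. -/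
theorem normDet_tilt {ν₁ : Euc (n + 1)} (hν : ‖ν₁‖ = 1) (hc : 0 < inner ℝ ν₁ e) :
    (fr.tilt ν₁).normDet = (inner ℝ ν₁ e)⁻¹ := by
  set c := inner ℝ ν₁ e with hcdef
  have hb : ∀ u, inner ℝ ν₁ (fr.incl u) = inner ℝ (fr.proj ν₁) u := fun u => by
    rw [fr.inner_eq, fr.inner_incl]; simp
  have hnorm : inner ℝ (fr.proj ν₁) (fr.proj ν₁) + c * c = 1 := by
    have := fr.inner_eq ν₁ ν₁
    rw [real_inner_self_eq_norm_sq, hν, real_inner_comm ν₁ e, ← hcdef] at this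
    linarith
  have hadj : (LinearMap.adjoint (fr.tilt ν₁)) ∘ₗ (fr.tilt ν₁) =
      LinearMap.transvection (innerₛₗ ℝ ((c⁻¹ * c⁻¹) • fr.proj ν₁)) (fr.proj ν₁) := by
    ext1 u
    refine ext_inner_right ℝ fun w => ?_
    rw [LinearMap.comp_apply, LinearMap.adjoint_inner_left, fr.tilt_apply, fr.tilt_apply,
      sub_eq_add_neg, sub_eq_add_neg, ← neg_smul, ← neg_smul, fr.inner_point_point, hb, hb,
      LinearMap.transvection.apply, inner_add_left]
    simp [inner_smul_left]
    ring
  have hsq := LinearMap.normDet_sq (fr.tilt ν₁)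
  rw [hadj, LinearMap.transvection.det] at hsq
  have h2 : (fr.tilt ν₁).normDet ^ 2 = (c⁻¹) ^ 2 := by
    have h3 : (fr.tilt ν₁).normDet ^ 2 =
      1 + c⁻¹ * c⁻¹ * inner ℝ (fr.proj ν₁) (fr.proj ν₁) := by
      rw [innerₛₗ_apply_apply, real_inner_smul_left] at hsq
      exact hsq
    rw [h3, ← sub_eq_iff_eq_add.2 hnorm.symm]
    field_simp
    ring
  exact (sq_eq_sq₀ (fr.tilt ν₁).normDet_nonneg (inv_nonneg.2 hc.le)).1 h2

/-- If `S` is flat to first order at `x₁`, with normal `ν₁`, then the projection along `e`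
multiplies `n`-dimensional Hausdorff measure on `S` near `x₁` by `⟪ν₁, e⟫`, up to a factor close to
`1`. The projection onto the tangent hyperplane along `e` is there `K`-bilipschitz, and on this
hyperplane `normDet_tilt` gives the exact factor. -/
theorem exists_nhds_measure_compare {S : Set (Euc (n + 1))} {x₁ ν₁ : Euc (n + 1)}
    (hν : ‖ν₁‖ = 1) (hc : 0 < inner ℝ ν₁ e)
    (hflat : ∀ δ > 0, ∃ N ∈ 𝓝 x₁, ∀ x ∈ S ∩ N, ∀ y ∈ S ∩ N, |inner ℝ ν₁ (x - y)| ≤ δ * ‖x - y‖)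
    {K : NNReal} (hK : 1 < K) :
    ∃ N ∈ 𝓝 x₁, ∀ A ⊆ S ∩ N,
      ENNReal.ofReal (inner ℝ ν₁ e) * (Measure.euclideanHausdorffMeasure n A) ≤
        (K : ℝ≥0∞) ^ n * volume (fr.proj '' A) ∧
      volume (fr.proj '' A) ≤
        (K : ℝ≥0∞) ^ n * (ENNReal.ofReal (inner ℝ ν₁ e)
            * Measure.euclideanHausdorffMeasure n A) := by
  set c := inner ℝ ν₁ e with hcdef
  have hK1 : (1 : ℝ) < K := by exact_mod_cast hK
  have hK0 : (0 : ℝ) < K := by linarith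
  -- the slack for which a map `η`-close to the identity is `K`-bilipschitz
  have hη : (0 : ℝ) < 1 - (K : ℝ)⁻¹ := by
    have := inv_lt_one_of_one_lt₀ hK1; linarith
  obtain ⟨N, hN, hNf⟩ := hflat (c * (1 - (K : ℝ)⁻¹)) (mul_pos hc hη)
  refine ⟨N, hN, fun A hA => ?_⟩
  let T : Euc (n + 1) → Euc (n + 1) := fun x => fr.tilt ν₁ (fr.proj x)
  have hT : ∀ x ∈ A, ∀ y ∈ A, ‖(T x - T y) - (x - y)‖ ≤ (1 - (K : ℝ)⁻¹) * ‖x - y‖ := by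
    intro x hx y hy
    have h1 : (T x - T y) - (x - y) = - ((c⁻¹ * inner ℝ ν₁ (x - y)) • e) := by
      simp only [T]
      rw [← map_sub, ← map_sub, fr.tilt_proj hc.ne']
      simp [hcdef]
    rw [h1, norm_neg, norm_smul, fr.norm_eq, mul_one, Real.norm_eq_abs, abs_mul,
      abs_of_pos (inv_pos.2 hc)]
    have := hNf x (hA hx) y (hA hy)
    calc c⁻¹ * |inner ℝ ν₁ (x - y)| ≤ c⁻¹ * (c * (1 - (K : ℝ)⁻¹) * ‖x - y‖) := by gcongr
      _ = _ := by field_simp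
  have hTlip : LipschitzOnWith K T A := by
    refine LipschitzOnWith.of_dist_le_mul fun x hx y hy => ?_
    rw [dist_eq_norm, dist_eq_norm]
    have h1 := hT x hx y hy
    have h2 : ‖T x - T y‖ ≤ ‖(T x - T y) - (x - y)‖ + ‖x - y‖ := by
      simpa using norm_add_le ((T x - T y) - (x - y)) (x - y)
    have h3 : (1 - (K : ℝ)⁻¹) + 1 ≤ K := by
      have : (K : ℝ) * (K : ℝ)⁻¹ = 1 := mul_inv_cancel₀ hK0.ne'
      have := inv_pos.2 hK0
      nlinarith [sq_nonneg ((K : ℝ) - 1)]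
    nlinarith [norm_nonneg (x - y)]
  have hTanti : ∀ x ∈ A, ∀ y ∈ A, ‖x - y‖ ≤ K * ‖T x - T y‖ := by
    intro x hx y hy
    have h1 := hT x hx y hy
    have h2 : ‖x - y‖ ≤ ‖(T x - T y) - (x - y)‖ + ‖T x - T y‖ := by
      have := norm_sub_le (T x - T y) ((T x - T y) - (x - y))
      rw [sub_sub_cancel] at this; linarith
    have h3 : (K : ℝ)⁻¹ * ‖x - y‖ ≤ ‖T x - T y‖ := by linarith
    calc ‖x - y‖ = K * ((K : ℝ)⁻¹ * ‖x - y‖) := by field_simp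
      _ ≤ _ := by gcongr
  have hTinj : InjOn T A := fun x hx y hy hxy => by
    have := hTanti x hx y hy
    rw [hxy, sub_self, norm_zero, mul_zero] at this
    exact sub_eq_zero.1 (norm_le_zero_iff.1 this)
  have hle1 : (Measure.euclideanHausdorffMeasure n (T '' A)) ≤
      (K : ℝ≥0∞) ^ n * Measure.euclideanHausdorffMeasure n A :=
    hTlip.euclideanHausdorffMeasure_image_le n
  have hle2 : (Measure.euclideanHausdorffMeasure n A) ≤
      (K : ℝ≥0∞) ^ n * Measure.euclideanHausdorffMeasure n (T '' A) := by
    have hlip : LipschitzOnWith K (Function.invFunOn T A) (T '' A) := by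
      refine LipschitzOnWith.of_dist_le_mul ?_
      rintro _ ⟨x, hx, rfl⟩ _ ⟨y, hy, rfl⟩
      rw [hTinj.leftInvOn_invFunOn hx, hTinj.leftInvOn_invFunOn hy, dist_eq_norm, dist_eq_norm]
      exact hTanti x hx y hy
    have := hlip.euclideanHausdorffMeasure_image_le n
    rwa [hTinj.leftInvOn_invFunOn.image_image] at this
  have hvol : volume (fr.proj '' A) =
      ENNReal.ofReal c * Measure.euclideanHausdorffMeasure n (T '' A) := by
    have h := LinearMap.euclideanHausdorffMeasure_image_eq_normDet_mul_volume (fr.tilt ν₁)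
      (fr.proj '' A)
    rw [image_image, fr.normDet_tilt hν hc, finrank_euclideanSpace, Fintype.card_fin] at h
    change _ = ENNReal.ofReal c * Measure.euclideanHausdorffMeasure n ((fun x => fr.tilt ν₁
        (fr.proj x)) '' A)
    rw [h, ← mul_assoc, ← ENNReal.ofReal_mul hc.le, mul_inv_cancel₀ hc.ne', ENNReal.ofReal_one,
      one_mul]
  rw [hvol]
  constructor
  · rw [mul_left_comm]; gcongr
  · rw [mul_left_comm]; gcongr

/-- The area formula for a graph: if the part `S ∩ U` of a hypersurface is the graph over `V` of
`G`, then Lebesgue measure on `V` is carried by `G` to `⟪ν, e⟫` times the surface measure. Both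
measures agree locally up to a factor `K ^ (n + 1)` for every `K > 1`, so they are equal. -/
theorem map_graph_volume {S U : Set (Euc (n + 1))} (hS : MeasurableSet S) (hU : IsOpen U)
    {V : Set (Euc n)} (hV : MeasurableSet V) {G : Euc n → Euc (n + 1)} (hGc : ContinuousOn G V)
    (hG : ∀ y ∈ V, G y ∈ S ∩ U ∧ fr.proj (G y) = y)
    (hP : ∀ x ∈ S ∩ U, fr.proj x ∈ V ∧ G (fr.proj x) = x)
    {ν : Euc (n + 1) → Euc (n + 1)} (hνc : ContinuousOn ν S) (hν : ∀ x ∈ S, ‖ν x‖ = 1)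
    (hflat : ∀ x₁ ∈ S, ∀ δ > 0, ∃ N ∈ 𝓝 x₁, ∀ x ∈ S ∩ N, ∀ y ∈ S ∩ N,
      |inner ℝ (ν x₁) (x - y)| ≤ δ * ‖x - y‖)
    (hpos : ∀ x ∈ S ∩ U, 0 < inner ℝ (ν x) e) :
    Measure.map G (volume.restrict V) =
      ((Measure.euclideanHausdorffMeasure n).restrict (S ∩ U)).withDensity
        (fun x => ENNReal.ofReal (inner ℝ (ν x) e)) := by
  have hSU : MeasurableSet (S ∩ U) := hS.inter hU.measurableSet
  have hGm : AEMeasurable G (volume.restrict V) := hGc.aemeasurable hV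
  -- `lam` is Lebesgue measure of the projection, `tau` is the weighted surface measure
  set lam := Measure.map G (volume.restrict V) with hlam
  set tau := ((Measure.euclideanHausdorffMeasure n).restrict (S ∩ U)).withDensity
        (fun x => ENNReal.ofReal (inner ℝ (ν x) e)) with htau
  have hlamA : ∀ A ⊆ S ∩ U, MeasurableSet A → lam A = volume (fr.proj '' A) := by
    intro A hA hAm
    rw [hlam, Measure.map_apply_of_aemeasurable hGm hAm, Measure.restrict_apply' hV]
    congr 1
    ext y
    constructor
    · rintro ⟨hy, hyV⟩
      exact ⟨G y, hy, (hG y hyV).2⟩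
    · rintro ⟨x, hx, rfl⟩
      obtain ⟨h1, h2⟩ := hP x (hA hx)
      exact ⟨by rw [mem_preimage, h2]; exact hx, h1⟩
  have htauA : ∀ A ⊆ S ∩ U, MeasurableSet A → tau A =
      ∫⁻ x in A, ENNReal.ofReal (inner ℝ (ν x) e) ∂(Measure.euclideanHausdorffMeasure n) := by
    intro A hA hAm
    rw [htau, withDensity_apply _ hAm, Measure.restrict_restrict hAm, inter_eq_left.2 hA]
  have hlam0 : lam (S ∩ U)ᶜ = 0 := by
    rw [hlam, Measure.map_apply_of_aemeasurable hGm hSU.compl, Measure.restrict_apply' hV]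
    convert measure_empty (μ := (volume : Measure (Euc n)))
    ext y
    simp only [mem_inter_iff, mem_preimage, mem_compl_iff, mem_empty_iff_false, iff_false]
    rintro ⟨h1, h2⟩
    exact h1 (hG y h2).1
  have htau0 : tau (S ∩ U)ᶜ = 0 := by
    refine withDensity_absolutelyContinuous _ _ ?_
    rw [Measure.restrict_apply hSU.compl, compl_inter_self, measure_empty]
  -- one factor `K` is spent on the variation of `⟪ν, e⟫` near `x`, the others on
  -- `exists_nhds_measure_compare`
  have key : ∀ K : NNReal, 1 < K → ∀ x ∈ S ∩ U, ∃ N ∈ 𝓝 x, ∀ A ⊆ (S ∩ U) ∩ N, MeasurableSet A →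
      tau A ≤ (K : ℝ≥0∞) ^ (n + 1) * lam A ∧ lam A ≤ (K : ℝ≥0∞) ^ (n + 1) * tau A := by
    intro K hK x₁ hx₁
    have hc := hpos x₁ hx₁
    set c := inner ℝ (ν x₁) e with hcdef
    have hK1 : (1 : ℝ) < K := by exact_mod_cast hK
    have hK0 : (0 : ℝ) < K := by linarith
    obtain ⟨N, hN, hNc⟩ := fr.exists_nhds_measure_compare (hν x₁ hx₁.1) hc (hflat x₁ hx₁.1) hK
    have hcont : ContinuousWithinAt (fun x => inner ℝ (ν x) e) S x₁ :=
      (hνc x₁ hx₁.1).inner continuousWithinAt_const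
    have h1 : ∀ᶠ x in 𝓝[S] x₁, inner ℝ (ν x) e < K * c :=
      hcont.eventually_lt_const (by change c < K * c; nlinarith)
    have h2 : ∀ᶠ x in 𝓝[S] x₁, (K : ℝ)⁻¹ * c < inner ℝ (ν x) e :=
      hcont.eventually_const_lt (by
        change (K : ℝ)⁻¹ * c < c
        have := inv_lt_one_of_one_lt₀ hK1
        nlinarith)
    obtain ⟨N', hN', hNN'⟩ := mem_nhdsWithin_iff_exists_mem_nhds_inter.1 (h1.and h2)
    refine ⟨N ∩ N', inter_mem hN hN', fun A hA hAm => ?_⟩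
    have hAS : A ⊆ S ∩ U := fun x hx => (hA hx).1
    rw [hlamA A hAS hAm, htauA A hAS hAm]
    obtain ⟨hc1, hc2⟩ := hNc A fun x hx => ⟨(hAS hx).1, (hA hx).2.1⟩
    have hup : ∫⁻ x in A, ENNReal.ofReal (inner ℝ (ν x) e) ∂(Measure.euclideanHausdorffMeasure n)
        ≤ K * (ENNReal.ofReal c * Measure.euclideanHausdorffMeasure n A) := by
      calc _ ≤ ∫⁻ x in A, K * ENNReal.ofReal c ∂(Measure.euclideanHausdorffMeasure n) := by
            refine setLIntegral_mono' hAm fun x hx => ?_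
            have h : inner ℝ (ν x) e ≤ K * c := (hNN' ⟨(hA hx).2.2, (hAS hx).1⟩).1.le
            refine (ENNReal.ofReal_le_ofReal h).trans_eq ?_
            rw [ENNReal.ofReal_mul hK0.le, ENNReal.ofReal_coe_nnreal]
        _ = _ := by rw [setLIntegral_const, mul_assoc]
    have hlow : ENNReal.ofReal c * Measure.euclideanHausdorffMeasure n A ≤
        K * ∫⁻ x in A, ENNReal.ofReal (inner ℝ (ν x) e) ∂(Measure.euclideanHausdorffMeasure n) := by
      rw [← lintegral_const_mul' _ _ ENNReal.coe_ne_top, ← setLIntegral_const]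
      refine setLIntegral_mono' hAm fun x hx => ?_
      have h : (K : ℝ)⁻¹ * c < inner ℝ (ν x) e := (hNN' ⟨(hA hx).2.2, (hAS hx).1⟩).2
      have h' : c ≤ K * inner ℝ (ν x) e := by
        rw [inv_mul_eq_div, div_lt_iff₀ hK0] at h; linarith
      refine (ENNReal.ofReal_le_ofReal h').trans_eq ?_
      rw [ENNReal.ofReal_mul hK0.le, ENNReal.ofReal_coe_nnreal]
    constructor
    · refine hup.trans ?_
      rw [pow_succ', mul_assoc]
      gcongr
    · refine hc2.trans ?_
      rw [pow_succ, mul_assoc]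
      gcongr
  have h1 : ∀ K : NNReal, 1 < K → ∀ A ⊆ S ∩ U, MeasurableSet A →
      tau A ≤ (K : ℝ≥0∞) ^ (n + 1) * lam A := fun K hK A =>
    measure_le_mul_of_locally (fun x hx => by
      obtain ⟨N, hN, h⟩ := key K hK x hx
      exact ⟨N, hN, fun A hA hAm => (h A hA hAm).1⟩)
  have h2 : ∀ K : NNReal, 1 < K → ∀ A ⊆ S ∩ U, MeasurableSet A →
      lam A ≤ (K : ℝ≥0∞) ^ (n + 1) * tau A := fun K hK A =>
    measure_le_mul_of_locally (fun x hx => by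
      obtain ⟨N, hN, h⟩ := key K hK x hx
      exact ⟨N, hN, fun A hA hAm => (h A hA hAm).2⟩)
  have lim : ∀ a b : ℝ≥0∞, (∀ K : NNReal, 1 < K → a ≤ (K : ℝ≥0∞) ^ (n + 1) * b) → a ≤ b := by
    intro a b hab
    have ht : Tendsto (fun K : NNReal => (K : ℝ≥0∞) ^ (n + 1) * b) (𝓝[>] 1) (𝓝 b) := by
      have h0 : Tendsto (fun K : NNReal => (K : ℝ≥0∞) ^ (n + 1)) (𝓝[>] 1) (𝓝 1) := by
        have : Continuous (fun K : NNReal => (K : ℝ≥0∞) ^ (n + 1)) :=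
          (ENNReal.continuous_pow _).comp ENNReal.continuous_coe
        simpa using (this.tendsto 1).mono_left nhdsWithin_le_nhds
      simpa using ENNReal.Tendsto.mul_const h0 (Or.inl one_ne_zero)
    exact ge_of_tendsto ht (eventually_nhdsWithin_of_forall fun K hK => hab K hK)
  ext A hAm
  have split : ∀ m : Measure (Euc (n + 1)), m (S ∩ U)ᶜ = 0 → m A = m (A ∩ (S ∩ U)) := by
    intro m hm
    rw [← measure_inter_add_sdiff A hSU, measure_mono_null (s := A \ (S ∩ U)) (fun x hx => hx.2) hm,
      add_zero]
  rw [split lam hlam0, split tau htau0]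
  have hs : A ∩ (S ∩ U) ⊆ S ∩ U := inter_subset_right
  exact le_antisymm (lim _ _ fun K hK => h2 K hK _ hs (hAm.inter hSU))
    (lim _ _ fun K hK => h1 K hK _ hs (hAm.inter hSU))

end Frame

/-! ### Local structure of an interface -/

theorem IsUnitNormalAt.norm_eq_one {d : ℕ} {S : Set (Euc d)} {x m : Euc d}
    (h : IsUnitNormalAt S x m) : ‖m‖ = 1 := by
  obtain ⟨ρ, hρ, rfl⟩ := h
  rw [norm_smul, norm_inv, norm_norm, inv_mul_cancel₀ (norm_ne_zero_iff.2 hρ.gradient_ne_zero)]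

/-- A hypersurface is flat to first order: secants at nearby points are almost tangent. This uses
strict differentiability of a defining function. -/
theorem IsUnitNormalAt.exists_flat {d : ℕ} {S : Set (Euc d)} {x₁ m : Euc d}
    (h : IsUnitNormalAt S x₁ m) {δ : ℝ} (hδ : 0 < δ) :
    ∃ N ∈ 𝓝 x₁, ∀ x ∈ S ∩ N, ∀ y ∈ S ∩ N, |inner ℝ m (x - y)| ≤ δ * ‖x - y‖ := by
  obtain ⟨ρ, hρ, rfl⟩ := h
  have hg := norm_pos_iff.2 hρ.gradient_ne_zero
  have h1 := (hρ.contDiff.contDiffAt (x := x₁)).hasStrictFDerivAt (by simp)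
  have h2 := h1.isLittleO.bound (mul_pos hδ hg)
  rw [nhds_prod_eq] at h2
  obtain ⟨N, hN, hN2⟩ := eventually_prod_self_iff (r := fun x y =>
    ‖ρ x - ρ y - fderiv ℝ ρ x₁ (x - y)‖ ≤ δ * ‖∇ ρ x₁‖ * ‖x - y‖) |>.1 h2
  refine ⟨N ∩ {y | y ∈ S ↔ ρ y = 0}, inter_mem hN hρ.mem_iff, ?_⟩
  rintro x ⟨hxS, hxN, hx⟩ y ⟨hyS, hyN, hy⟩
  have h3 := hN2 x hxN y hyN
  simp only [hx.1 hxS, hy.1 hyS, sub_self, zero_sub, norm_neg] at h3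
  rw [← inner_gradient_left (𝕜 := ℝ), Real.norm_eq_abs] at h3
  rw [real_inner_smul_left, abs_mul, abs_of_pos (inv_pos.2 hg), inv_mul_le_iff₀ hg]
  linarith

/-- A family of segments `J y`, `y ∈ V`, with a common endpoint parameter `b`, whose images under
`Φ` avoid the complement of two disjoint open sets, lies in one of them as soon as it meets it.
It decides on which side of a graph each of the two open sets lies. -/
theorem forall_mem_of_mem_of_disjoint_union {E X : Type*} [TopologicalSpace E] [TopologicalSpace X]
    {A B : Set X} (hA : IsOpen A) (hB : IsOpen B) (hAB : Disjoint A B) {Φ : E × ℝ → X}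
    (hΦ : Continuous Φ) {V : Set E} (hV : IsPreconnected V) {b : ℝ} {J : E → Set ℝ}
    (hJ : ∀ y ∈ V, (J y).OrdConnected ∧ b ∈ J y)
    (hsub : ∀ y ∈ V, ∀ t ∈ J y, Φ (y, t) ∈ A ∪ B)
    (hex : ∃ y ∈ V, ∃ t ∈ J y, Φ (y, t) ∈ A) :
    ∀ y ∈ V, ∀ t ∈ J y, Φ (y, t) ∈ A := by
  have hvert : ∀ y ∈ V, (∃ t ∈ J y, Φ (y, t) ∈ A) → ∀ t ∈ J y, Φ (y, t) ∈ A := by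
    rintro y hy ⟨t₀, ht₀, hA₀⟩ t ht
    have hpre : IsPreconnected ((fun t => Φ (y, t)) '' J y) :=
      ((hJ y hy).1.isPreconnected).image _ (by fun_prop)
    have hne : ((fun t => Φ (y, t)) '' J y ∩ A).Nonempty := ⟨_, ⟨t₀, ht₀, rfl⟩, hA₀⟩
    refine hpre.subset_left_of_subset_union hA hB hAB ?_ hne
      (mem_image_of_mem (fun t => Φ (y, t)) ht)
    rintro _ ⟨s, hs, rfl⟩
    exact hsub y hy s hs
  obtain ⟨y₀, hy₀, h₀⟩ := hex
  have hpre : IsPreconnected ((fun y => Φ (y, b)) '' V) := hV.image _ (by fun_prop)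
  have hbase : (fun y => Φ (y, b)) '' V ⊆ A := by
    have hne : ((fun y => Φ (y, b)) '' V ∩ A).Nonempty :=
      ⟨_, ⟨y₀, hy₀, rfl⟩, hvert y₀ hy₀ h₀ b (hJ y₀ hy₀).2⟩
    refine hpre.subset_left_of_subset_union hA hB hAB ?_ hne
    rintro _ ⟨s, hs, rfl⟩
    exact hsub s hs b (hJ s hs).2
  exact fun y hy => hvert y hy ⟨b, (hJ y hy).2, hbase ⟨y, hy, rfl⟩⟩

namespace IsInterface

variable {d : ℕ} {Ωi Ωo : Opens (Euc d)} {S : Set (Euc d)} {ν : Euc d → Euc d}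

theorem eq_compl (hS : IsInterface Ωi S Ωo ν) : S = ((Ωi : Set (Euc d)) ∪ Ωo)ᶜ := by
  ext x
  constructor
  · rintro hx (h | h)
    · exact Set.disjoint_left.1 hS.disjoint_left h hx
    · exact Set.disjoint_left.1 hS.disjoint_right hx h
  · intro hx
    have : x ∈ (Ωi : Set (Euc d)) ∪ S ∪ Ωo := by rw [hS.cover]; trivial
    rcases this with (h | h) | h
    · exact absurd (Or.inl h) hx
    · exact h
    · exact absurd (Or.inr h) hx

theorem isClosed (hS : IsInterface Ωi S Ωo ν) : IsClosed S := by
  rw [hS.eq_compl]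
  exact (Ωi.isOpen.union Ωo.isOpen).isClosed_compl

theorem norm_normal (hS : IsInterface Ωi S Ωo ν) {x : Euc d} (hx : x ∈ S) : ‖ν x‖ = 1 :=
  (hS.normal x hx).norm_eq_one

end IsInterface

/-- A local defining function is negative just behind the hypersurface and positive just in front of
it, seen along its normalised gradient. -/
theorem IsLocalDefiningFunction.eventually_sign {d : ℕ} {S : Set (Euc d)} {x : Euc d}
    {ρ : Euc d → ℝ} (hρ : IsLocalDefiningFunction S x ρ) (hx : x ∈ S) :
    (∀ᶠ t : ℝ in 𝓝[>] 0, ρ (x - t • (‖∇ ρ x‖⁻¹ • ∇ ρ x)) < 0) ∧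
      ∀ᶠ t : ℝ in 𝓝[>] 0, 0 < ρ (x + t • (‖∇ ρ x‖⁻¹ • ∇ ρ x)) := by
  have hg := norm_pos_iff.2 hρ.gradient_ne_zero
  have hρx : ρ x = 0 := hρ.mem_iff.self_of_nhds.1 hx
  have hd : HasFDerivAt ρ (fderiv ℝ ρ x) x :=
    (hρ.contDiff.differentiable (by simp) x).hasFDerivAt
  have main : ∀ v : Euc d, Tendsto (fun t : ℝ => t⁻¹ * ρ (x + t • v)) (𝓝[>] 0)
      (𝓝 (inner ℝ (∇ ρ x) v)) := by
    intro v
    have h1 : HasDerivAt (fun t : ℝ => ρ (x + t • v)) (inner ℝ (∇ ρ x) v) 0 := by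
      rw [inner_gradient_left]
      have h2 : HasDerivAt (fun t : ℝ => x + t • v) v 0 := by
        simpa using ((hasDerivAt_id (0 : ℝ)).smul_const v).const_add x
      have h3 : HasFDerivAt ρ (fderiv ℝ ρ x) (x + (0 : ℝ) • v) := by simpa using hd
      exact h3.comp_hasDerivAt 0 h2
    have h4 := (hasDerivAt_iff_tendsto_slope_zero.1 h1).mono_left
      (nhdsWithin_mono 0 (show Ioi (0 : ℝ) ⊆ {0}ᶜ from fun t ht => ne_of_gt ht))
    simpa [hρx] using h4
  have hpos : 0 < inner ℝ (∇ ρ x) (‖∇ ρ x‖⁻¹ • ∇ ρ x) := by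
    rw [real_inner_smul_right, real_inner_self_eq_norm_sq]
    positivity
  constructor
  · have h1 := main (-(‖∇ ρ x‖⁻¹ • ∇ ρ x))
    rw [inner_neg_right] at h1
    filter_upwards [h1.eventually_lt_const (neg_neg_of_pos hpos), self_mem_nhdsWithin] with t ht ht0
    rw [smul_neg, ← sub_eq_add_neg] at ht
    by_contra! hcon
    exact absurd ht (not_lt.2 (mul_nonneg (inv_nonneg.2 (le_of_lt ht0)) hcon))
  · filter_upwards [(main _).eventually_const_lt hpos, self_mem_nhdsWithin] with t ht ht0
    by_contra! hcon
    exact absurd ht (not_lt.2 (mul_nonpos_of_nonneg_of_nonpos (inv_nonneg.2 (le_of_lt ht0)) hcon))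

/-- A cylinder `base × (lower, upper)`, in the coordinates of the frame `fr`, in which `S` is the
graph of `height`, the set `Ωi` is the region below the graph, and the normal has positive component
along `e`. -/
structure GraphBox {n : ℕ} {e : Euc (n + 1)} (fr : Frame e) (Ωi : Opens (Euc (n + 1)))
    (S : Set (Euc (n + 1))) (ν : Euc (n + 1) → Euc (n + 1)) where
  base : Set (Euc n)
  lower : ℝ
  upper : ℝ
  height : Euc n → ℝ
  isOpen_base : IsOpen base
  continuousOn_height : ContinuousOn height base
  height_mem : ∀ y ∈ base, height y ∈ Ioo lower upper
  mem_surface_iff : ∀ y ∈ base, ∀ t ∈ Ioo lower upper,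
    (fr.incl y + t • e ∈ S ↔ t = height y)
  mem_inside_iff : ∀ y ∈ base, ∀ t ∈ Ioo lower upper,
    (fr.incl y + t • e ∈ Ωi ↔ t < height y)
  inner_normal_pos : ∀ y ∈ base, 0 < inner ℝ (ν (fr.incl y + height y • e)) e

/-- The open subset of `ℝ^(n+1)` occupied by a graph box. -/
def GraphBox.region {n : ℕ} {e : Euc (n + 1)} {fr : Frame e} {Ωi : Opens (Euc (n + 1))}
    {S : Set (Euc (n + 1))} {ν : Euc (n + 1) → Euc (n + 1)} (B : GraphBox fr Ωi S ν) :
    Set (Euc (n + 1)) :=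
  {x | fr.proj x ∈ B.base ∧ inner ℝ e x ∈ Ioo B.lower B.upper}

/-- Every direction `e` that crosses the interface at `x₀` from inside to outside gives a graph box
around `x₀`. A defining function increases strictly along `e`, which is the implicit function
theorem in the form needed; the sides are identified by connectedness and the sign of the
defining function along the normal. -/
theorem IsInterface.exists_graphBox {n : ℕ} {Ωi Ωo : Opens (Euc (n + 1))} {S : Set (Euc (n + 1))}
    {ν : Euc (n + 1) → Euc (n + 1)} (hS : IsInterface Ωi S Ωo ν) {x₀ : Euc (n + 1)} (hx₀ : x₀ ∈ S)
    {e : Euc (n + 1)} (fr : Frame e) (hpos : 0 < inner ℝ (ν x₀) e) :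
    ∃ B : GraphBox fr Ωi S ν, x₀ ∈ B.region := by
  obtain ⟨ρ, hρ, hν⟩ := hS.normal x₀ hx₀
  have hg := norm_pos_iff.2 hρ.gradient_ne_zero
  have hρcont : Continuous ρ := hρ.contDiff.continuous
  have hfd : Continuous fun x => fderiv ℝ ρ x e :=
    (hρ.contDiff.continuous_fderiv (by simp)).clm_apply continuous_const
  have hpos' : 0 < fderiv ℝ ρ x₀ e := by
    rw [← inner_gradient_left (𝕜 := ℝ)]
    rw [hν, real_inner_smul_left] at hpos
    exact (mul_pos_iff_of_pos_left (inv_pos.2 hg)).1 hpos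
  have hνpos : ∀ᶠ x in 𝓝 x₀, x ∈ S → 0 < inner ℝ (ν x) e := by
    have hc : ContinuousWithinAt (fun x => inner ℝ (ν x) e) S x₀ :=
      (hS.normal_continuousOn x₀ hx₀).inner continuousWithinAt_const
    exact eventually_nhdsWithin_iff.1 (hc.eventually_const_lt hpos)
  have hW : ∀ᶠ x in 𝓝 x₀, (x ∈ S ↔ ρ x = 0) ∧ 0 < fderiv ℝ ρ x e ∧
      (x ∈ S → 0 < inner ℝ (ν x) e) :=
    hρ.mem_iff.and ((hfd.continuousAt.eventually_const_lt hpos').and hνpos)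
  let Φ : Euc n × ℝ → Euc (n + 1) := fun p => fr.incl p.1 + p.2 • e
  have hΦ : Continuous Φ := by
    have := fr.incl.continuous
    fun_prop
  set y₀ := fr.proj x₀ with hy₀
  set t₀ := inner ℝ e x₀ with ht₀
  have hΦ0 : Φ (y₀, t₀) = x₀ := fr.decomp x₀
  have hW' := (hΦ.tendsto (y₀, t₀)).eventually (by rw [hΦ0]; exact hW)
  rw [nhds_prod_eq] at hW'
  obtain ⟨u, hu, v, hv, huv⟩ := eventually_prod_iff.1 hW'
  obtain ⟨s, hs, hsv⟩ := Metric.nhds_basis_closedBall.mem_iff.1 hv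
  rw [Real.closedBall_eq_Icc] at hsv
  set a := t₀ - s with ha
  set b := t₀ + s with hb
  have hab : a < b := by linarith
  have hbox : ∀ y, u y → ∀ t ∈ Icc a b, (Φ (y, t) ∈ S ↔ ρ (Φ (y, t)) = 0) ∧
      0 < fderiv ℝ ρ (Φ (y, t)) e ∧ (Φ (y, t) ∈ S → 0 < inner ℝ (ν (Φ (y, t))) e) :=
    fun y hy t ht => huv hy (hsv ht)
  -- the defining function increases along the lines in direction `e`, so it has one zero on each
  have hmono : ∀ y, u y → StrictMonoOn (fun t => ρ (Φ (y, t))) (Icc a b) := by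
    intro y hy
    refine strictMonoOn_of_deriv_pos (convex_Icc a b) (by fun_prop) fun t ht => ?_
    have h2 : HasDerivAt (fun t : ℝ => Φ (y, t)) e t := by
      simpa [Φ] using ((hasDerivAt_id t).smul_const e).const_add (fr.incl y)
    have h3 := ((hρ.contDiff.differentiable (by simp) (Φ (y, t))).hasFDerivAt).comp_hasDerivAt t h2
    change 0 < deriv (ρ ∘ fun t => Φ (y, t)) t
    rw [h3.deriv]
    exact (hbox y hy t (interior_subset ht)).2.1
  have huy₀ : u y₀ := hu.self_of_nhds
  have h0 : ρ (Φ (y₀, t₀)) = 0 := by rw [hΦ0]; exact hρ.mem_iff.self_of_nhds.1 hx₀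
  have ht₀m : t₀ ∈ Icc a b := ⟨by linarith, by linarith⟩
  have hlow : ρ (Φ (y₀, a)) < 0 := by
    rw [← h0]; exact hmono y₀ huy₀ (left_mem_Icc.2 hab.le) ht₀m (by linarith)
  have hupp : 0 < ρ (Φ (y₀, b)) := by
    rw [← h0]; exact hmono y₀ huy₀ ht₀m (right_mem_Icc.2 hab.le) (by linarith)
  have hev : ∀ᶠ y in 𝓝 y₀, u y ∧ ρ (Φ (y, a)) < 0 ∧ 0 < ρ (Φ (y, b)) := by
    refine hu.and (Eventually.and ?_ ?_)
    · have : Continuous fun y => ρ (Φ (y, a)) := by fun_prop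
      exact this.continuousAt.eventually_lt_const hlow
    · have : Continuous fun y => ρ (Φ (y, b)) := by fun_prop
      exact this.continuousAt.eventually_const_lt hupp
  obtain ⟨r, hr, hrV⟩ := Metric.eventually_nhds_iff_ball.1 hev
  set V := Metric.ball y₀ r with hV
  have hex : ∀ y ∈ V, ∃ t ∈ Ioo a b, ρ (Φ (y, t)) = 0 := by
    intro y hy
    obtain ⟨_, h1, h2⟩ := hrV y hy
    have hc : ContinuousOn (fun t => ρ (Φ (y, t))) (Icc a b) := by fun_prop
    exact intermediate_value_Ioo hab.le hc ⟨h1, h2⟩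
  choose! f hf hf0 using hex
  have hfI : ∀ y ∈ V, f y ∈ Icc a b := fun y hy => Ioo_subset_Icc_self (hf y hy)
  have hneg : ∀ y ∈ V, ∀ t ∈ Icc a b, (ρ (Φ (y, t)) < 0 ↔ t < f y) := by
    intro y hy t ht
    rw [← hf0 y hy]
    exact (hmono y (hrV y hy).1).lt_iff_lt ht (hfI y hy)
  have hpos2 : ∀ y ∈ V, ∀ t ∈ Icc a b, (0 < ρ (Φ (y, t)) ↔ f y < t) := by
    intro y hy t ht
    rw [← hf0 y hy]
    exact (hmono y (hrV y hy).1).lt_iff_lt (hfI y hy) ht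
  have hzero : ∀ y ∈ V, ∀ t ∈ Icc a b, (Φ (y, t) ∈ S ↔ t = f y) := by
    intro y hy t ht
    rw [(hbox y (hrV y hy).1 t ht).1, ← hf0 y hy]
    exact (hmono y (hrV y hy).1).injOn.eq_iff ht (hfI y hy)
  have hcov : ∀ x, x ∉ S → x ∈ (Ωi : Set (Euc (n + 1))) ∪ Ωo := by
    intro x hx
    rw [hS.eq_compl] at hx
    exact not_not.1 hx
  have hnear : ∀ᶠ x in 𝓝 x₀, fr.proj x ∈ V ∧ inner ℝ e x ∈ Ioo a b := by
    refine Eventually.and ?_ ?_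
    · exact fr.proj.continuous.continuousAt.eventually_mem (Metric.ball_mem_nhds _ hr)
    · have hc : Continuous fun x : Euc (n + 1) => inner ℝ e x := by fun_prop
      exact hc.continuousAt.eventually_mem (Ioo_mem_nhds (by linarith) (by linarith))
  have hline : ∀ w : Euc (n + 1), Tendsto (fun t : ℝ => x₀ + t • w) (𝓝[>] 0) (𝓝 x₀) := by
    intro w
    have hc : Continuous fun t : ℝ => x₀ + t • w := by fun_prop
    simpa using (hc.tendsto 0).mono_left nhdsWithin_le_nhds
  have hsign := hρ.eventually_sign hx₀
  rw [← hν] at hsign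
  have hVpre : IsPreconnected V := (convex_ball y₀ r).isPreconnected
  have hbelow : ∀ y ∈ V, ∀ t ∈ Ico a (f y), Φ (y, t) ∈ (Ωi : Set (Euc (n + 1))) := by
    refine forall_mem_of_mem_of_disjoint_union Ωi.isOpen Ωo.isOpen hS.disjoint_sides hΦ hVpre
      (b := a) (J := fun y => Ico a (f y)) (fun y hy => ⟨ordConnected_Ico, ⟨le_rfl, (hf y hy).1⟩⟩)
      ?_ ?_
    · intro y hy t ht
      exact hcov _ fun h => ht.2.ne ((hzero y hy t ⟨ht.1, ht.2.le.trans (hfI y hy).2⟩).1 h)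
    · have hl := (hline (-ν x₀)).eventually hnear
      obtain ⟨t, h1, h2, h3⟩ := ((hS.points_inside x₀ hx₀).and (hsign.1.and hl)).exists
      rw [smul_neg, ← sub_eq_add_neg] at h3
      set p := x₀ - t • ν x₀ with hp
      have hpe : Φ (fr.proj p, inner ℝ e p) = p := fr.decomp p
      refine ⟨fr.proj p, h3.1, inner ℝ e p, ⟨h3.2.1.le, ?_⟩, by rw [hpe]; exact h1⟩
      rw [← hneg _ h3.1 _ (Ioo_subset_Icc_self h3.2), hpe]
      exact h2
  have habove : ∀ y ∈ V, ∀ t ∈ Ioc (f y) b, Φ (y, t) ∈ (Ωo : Set (Euc (n + 1))) := by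
    refine forall_mem_of_mem_of_disjoint_union Ωo.isOpen Ωi.isOpen hS.disjoint_sides.symm hΦ hVpre
      (b := b) (J := fun y => Ioc (f y) b) (fun y hy => ⟨ordConnected_Ioc, ⟨(hf y hy).2, le_rfl⟩⟩)
      ?_ ?_
    · intro y hy t ht
      rw [union_comm]
      exact hcov _ fun h => ht.1.ne' ((hzero y hy t ⟨(hfI y hy).1.trans ht.1.le, ht.2⟩).1 h)
    · have hl := (hline (ν x₀)).eventually hnear
      obtain ⟨t, h1, h2, h3⟩ := ((hS.points_outside x₀ hx₀).and (hsign.2.and hl)).exists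
      set p := x₀ + t • ν x₀ with hp
      have hpe : Φ (fr.proj p, inner ℝ e p) = p := fr.decomp p
      refine ⟨fr.proj p, h3.1, inner ℝ e p, ⟨?_, h3.2.2.le⟩, by rw [hpe]; exact h1⟩
      rw [← hpos2 _ h3.1 _ (Ioo_subset_Icc_self h3.2), hpe]
      exact h2
  refine ⟨⟨V, a, b, f, Metric.isOpen_ball, ?_, hf,
    fun y hy t ht => hzero y hy t (Ioo_subset_Icc_self ht), ?_, ?_⟩, ?_⟩
  · intro y hy
    have hVn : V ∈ 𝓝 y := Metric.isOpen_ball.mem_nhds hy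
    -- `height` is continuous, as `t < height z` and `height z < t` are sign conditions on `ρ`
    refine ContinuousAt.continuousWithinAt (tendsto_order.2 ⟨fun t ht => ?_, fun t ht => ?_⟩)
    · have hm : max t a ∈ Icc a b :=
        ⟨le_max_right _ _, max_le (ht.le.trans (hfI y hy).2) hab.le⟩
      have h1 : ρ (Φ (y, max t a)) < 0 := (hneg y hy _ hm).2 (max_lt ht (hf y hy).1)
      have hc : Continuous fun y => ρ (Φ (y, max t a)) := by fun_prop
      filter_upwards [hVn, hc.continuousAt.eventually_lt_const h1] with z hz hz1
      exact (le_max_left _ _).trans_lt ((hneg z hz _ hm).1 hz1)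
    · have hm : min t b ∈ Icc a b :=
        ⟨le_min ((hfI y hy).1.trans ht.le) hab.le, min_le_right _ _⟩
      have h1 : 0 < ρ (Φ (y, min t b)) := (hpos2 y hy _ hm).2 (lt_min ht (hf y hy).2)
      have hc : Continuous fun y => ρ (Φ (y, min t b)) := by fun_prop
      filter_upwards [hVn, hc.continuousAt.eventually_const_lt h1] with z hz hz1
      exact ((hpos2 z hz _ hm).1 hz1).trans_le (min_le_left _ _)
  · intro y hy t ht
    have htI := Ioo_subset_Icc_self ht
    constructor
    · intro h
      by_contra! hcon
      rcases hcon.eq_or_lt with h' | h'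
      · exact Set.disjoint_left.1 hS.disjoint_left h ((hzero y hy t htI).2 h'.symm)
      · exact Set.disjoint_left.1 hS.disjoint_sides h (habove y hy t ⟨h', ht.2.le⟩)
    · exact fun h => hbelow y hy t ⟨ht.1.le, h⟩
  · intro y hy
    exact (hbox y (hrV y hy).1 _ (hfI y hy)).2.2 ((hzero y hy _ (hfI y hy)).2 rfl)
  · exact hnear.self_of_nhds

/-! ### The surface measure and the divergence theorem -/

namespace IsInterface

variable {n : ℕ} {Ωi Ωo : Opens (Euc (n + 1))} {S : Set (Euc (n + 1))}
  {ν : Euc (n + 1) → Euc (n + 1)}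

/-- Near each point of `S`, the projection along the normal bounds the Hausdorff measure of `S` by
the Lebesgue measure of a bounded set. -/
theorem exists_nhds_hausdorff_lt_top (hS : IsInterface Ωi S Ωo ν) {x : Euc (n + 1)} (hx : x ∈ S) :
    ∃ N ∈ 𝓝 x, Measure.euclideanHausdorffMeasure n (S ∩ N) < ⊤ := by
  obtain ⟨fr⟩ := exists_frame (hS.norm_normal hx)
  have hin : inner ℝ (ν x) (ν x) = 1 := fr.inner_self
  obtain ⟨N, hN, h⟩ := fr.exists_nhds_measure_compare (hS.norm_normal hx) (by rw [hin]; norm_num)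
    (fun δ hδ => (hS.normal x hx).exists_flat hδ) (K := 2) (by norm_num)
  refine ⟨N ∩ Metric.closedBall x 1, inter_mem hN (Metric.closedBall_mem_nhds x one_pos), ?_⟩
  have h1 := (h (S ∩ (N ∩ Metric.closedBall x 1)) fun z hz => ⟨hz.1, hz.2.1⟩).1
  rw [hin, ENNReal.ofReal_one, one_mul] at h1
  refine h1.trans_lt (ENNReal.mul_lt_top (by simp) ?_)
  have hc : IsCompact (fr.proj '' Metric.closedBall x 1) :=
    (isCompact_closedBall x 1).image fr.proj.continuous
  exact (measure_mono (image_mono fun z hz => hz.2.2)).trans_lt hc.measure_lt_top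

theorem isLocallyFiniteMeasure (hS : IsInterface Ωi S Ωo ν) :
    IsLocallyFiniteMeasure (surfaceMeasure S) := by
  refine ⟨fun x => ?_⟩
  by_cases hx : x ∈ S
  · obtain ⟨N, hN, h⟩ := hS.exists_nhds_hausdorff_lt_top hx
    refine ⟨N, hN, ?_⟩
    rw [surfaceMeasure, Measure.restrict_apply' hS.isClosed.measurableSet, inter_comm]
    exact h
  · refine ⟨Sᶜ, hS.isClosed.isOpen_compl.mem_nhds hx, ?_⟩
    rw [surfaceMeasure, Measure.restrict_apply' hS.isClosed.measurableSet, compl_inter_self]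
    simp

theorem volume_eq_zero (hS : IsInterface Ωi S Ωo ν) : volume S = 0 := by
  refine measure_null_of_locally_null _ fun x hx => ?_
  obtain ⟨N, hN, h⟩ := hS.exists_nhds_hausdorff_lt_top hx
  refine ⟨S ∩ N, inter_mem self_mem_nhdsWithin (mem_nhdsWithin_of_mem_nhds hN), ?_⟩
  rw [← EuclideanSpace.euclideanHausdorffMeasure_eq_volume]
  exact (Measure.euclideanHausdorffMeasure_zero_or_top (Nat.lt_succ_self n) _).resolve_right h.ne

theorem aestronglyMeasurable_normal (hS : IsInterface Ωi S Ωo ν) :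
    AEStronglyMeasurable ν (surfaceMeasure S) :=
  hS.normal_continuousOn.aestronglyMeasurable hS.isClosed.measurableSet

theorem ae_norm_normal (hS : IsInterface Ωi S Ωo ν) :
    ∀ᵐ x ∂surfaceMeasure S, ‖ν x‖ = 1 :=
  ae_restrict_of_forall_mem hS.isClosed.measurableSet fun _ hx => hS.norm_normal hx

theorem integrable_mul_inner_normal (hS : IsInterface Ωi S Ωo ν) {f : Euc (n + 1) → ℝ}
    (hf : Integrable f (surfaceMeasure S)) (v : Euc (n + 1)) :
    Integrable (fun x => f x * inner ℝ (ν x) v) (surfaceMeasure S) := by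
  refine hf.mul_bdd (c := ‖v‖) (hS.aestronglyMeasurable_normal.inner aestronglyMeasurable_const) ?_
  filter_upwards [hS.ae_norm_normal] with x hx
  simpa [hx] using norm_inner_le_norm (𝕜 := ℝ) (ν x) v

end IsInterface

theorem GraphBox.isOpen_region {n : ℕ} {e : Euc (n + 1)} {fr : Frame e} {Ωi : Opens (Euc (n + 1))}
    {S : Set (Euc (n + 1))} {ν : Euc (n + 1) → Euc (n + 1)} (B : GraphBox fr Ωi S ν) :
    IsOpen B.region := by
  refine (B.isOpen_base.preimage fr.proj.continuous).inter (isOpen_Ioo.preimage ?_)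
  fun_prop

/-- The area formula in a graph box. -/
theorem GraphBox.map_volume {n : ℕ} {e : Euc (n + 1)} {fr : Frame e} {Ωi Ωo : Opens (Euc (n + 1))}
    {S : Set (Euc (n + 1))} {ν : Euc (n + 1) → Euc (n + 1)} (B : GraphBox fr Ωi S ν)
    (hS : IsInterface Ωi S Ωo ν) :
    Measure.map (fun y => fr.incl y + B.height y • e) (volume.restrict B.base) =
      ((Measure.euclideanHausdorffMeasure n).restrict (S ∩ B.region)).withDensity
        (fun x => ENNReal.ofReal (inner ℝ (ν x) e)) := by
  have hgraph : ∀ x ∈ S ∩ B.region, fr.proj x ∈ B.base ∧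
      fr.incl (fr.proj x) + B.height (fr.proj x) • e = x := by
    rintro x ⟨hxS, hx1, hx2⟩
    refine ⟨hx1, ?_⟩
    have h := (B.mem_surface_iff _ hx1 _ hx2).1 (by rw [fr.decomp]; exact hxS)
    rw [← h, fr.decomp]
  refine fr.map_graph_volume hS.isClosed.measurableSet B.isOpen_region
    B.isOpen_base.measurableSet ?_ ?_ hgraph hS.normal_continuousOn (fun x hx => hS.norm_normal hx)
    (fun x hx δ hδ => (hS.normal x hx).exists_flat hδ) ?_
  · exact fr.incl.continuous.continuousOn.add (B.continuousOn_height.smul continuousOn_const)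
  · intro y hy
    refine ⟨⟨(B.mem_surface_iff y hy _ (B.height_mem y hy)).2 rfl, ?_, ?_⟩, fr.proj_point _ _⟩
    · rw [fr.proj_point]; exact hy
    · rw [fr.inner_point]; exact B.height_mem y hy
  · intro x hx
    obtain ⟨h1, h2⟩ := hgraph x hx
    have := B.inner_normal_pos _ h1
    rwa [h2] at this

/-- The divergence theorem in a graph box for derivatives along `e`: by Fubini and the fundamental
theorem of calculus the left side is an integral of `ψ` over the graph with respect to Lebesgue
measure on the base, which `GraphBox.map_volume` turns into a surface integral. -/
theorem GraphBox.integral_fderiv {n : ℕ} {e : Euc (n + 1)} {fr : Frame e}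
    {Ωi Ωo : Opens (Euc (n + 1))}
    {S : Set (Euc (n + 1))} {ν : Euc (n + 1) → Euc (n + 1)} (B : GraphBox fr Ωi S ν)
    (hS : IsInterface Ωi S Ωo ν) {ψ : Euc (n + 1) → ℝ} (hψ : ContDiff ℝ 1 ψ)
    (hc : HasCompactSupport ψ) (hsupp : tsupport ψ ⊆ B.region) :
    ∫ x in Ωi, fderiv ℝ ψ x e = ∫ x, ψ x * inner ℝ (ν x) e ∂surfaceMeasure S := by
  have hcont : Continuous fun x => fderiv ℝ ψ x e :=
    (hψ.continuous_fderiv one_ne_zero).clm_apply continuous_const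
  have hcs : HasCompactSupport fun x => fderiv ℝ ψ x e := hc.fderiv_apply ℝ e
  have hint : Integrable fun x => fderiv ℝ ψ x e := hcont.integrable_of_hasCompactSupport hcs
  have hout : ∀ x, x ∉ B.region → ψ x = 0 := fun x hx =>
    image_eq_zero_of_notMem_tsupport fun h => hx (hsupp h)
  have hout' : ∀ x, x ∉ B.region → fderiv ℝ ψ x = 0 := fun x hx =>
    image_eq_zero_of_notMem_tsupport fun h => hx (hsupp (tsupport_fderiv_subset ℝ h))
  -- reduction to iterated integrals along the lines in direction `e`
  have hleft : ∫ x in Ωi, fderiv ℝ ψ x e = ∫ y in B.base, ψ (fr.incl y + B.height y • e) := by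
    have hintI : Integrable ((Ωi : Set (Euc (n + 1))).indicator fun x => fderiv ℝ ψ x e) :=
      hint.indicator Ωi.isOpen.measurableSet
    rw [← integral_indicator Ωi.isOpen.measurableSet, ← fr.measurePreserving.map_eq,
      integral_map fr.measurePreserving.measurable.aemeasurable
        (by rw [fr.measurePreserving.map_eq]; exact hintI.aestronglyMeasurable)]
    have hintI' := (fr.measurePreserving.integrable_comp hintI.aestronglyMeasurable).2 hintI
    rw [Measure.volume_eq_prod] at hintI' ⊢
    change ∫ p, (((Ωi : Set (Euc (n + 1))).indicator fun x => fderiv ℝ ψ x e) ∘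
      fun p : Euc n × ℝ => fr.incl p.1 + p.2 • e) p ∂_ = _
    rw [integral_prod _ hintI', ← integral_indicator B.isOpen_base.measurableSet]
    congr 1
    ext y
    by_cases hy : y ∈ B.base
    · rw [indicator_of_mem hy]
      have hd : ∀ t : ℝ, HasDerivAt (fun t : ℝ => ψ (fr.incl y + t • e))
          (fderiv ℝ ψ (fr.incl y + t • e) e) t := by
        intro t
        have h2 : HasDerivAt (fun t : ℝ => fr.incl y + t • e) e t := by
          simpa using ((hasDerivAt_id t).smul_const e).const_add (fr.incl y)
        exact ((hψ.differentiable one_ne_zero _).hasFDerivAt).comp_hasDerivAt t h2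
      have heq : (fun t : ℝ => (Ωi : Set (Euc (n + 1))).indicator (fun x => fderiv ℝ ψ x e)
          (fr.incl y + t • e)) =
          (Ioo B.lower (B.height y)).indicator fun t => fderiv ℝ ψ (fr.incl y + t • e) e := by
        ext t
        by_cases ht : t ∈ Ioo B.lower B.upper
        · have hiff : fr.incl y + t • e ∈ (Ωi : Set (Euc (n + 1))) ↔
              t ∈ Ioo B.lower (B.height y) :=
            (B.mem_inside_iff y hy t ht).trans ⟨fun h => ⟨ht.1, h⟩, fun h => h.2⟩
          by_cases hlt : t ∈ Ioo B.lower (B.height y)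
          · rw [indicator_of_mem hlt, indicator_of_mem (hiff.2 hlt)]
          · rw [indicator_of_notMem hlt, indicator_of_notMem fun h => hlt (hiff.1 h)]
        · have h0 : fderiv ℝ ψ (fr.incl y + t • e) = 0 :=
            hout' _ fun h => ht (by have := h.2; rwa [fr.inner_point] at this)
          simp [indicator, h0]
      simp only [Function.comp_apply]
      rw [heq, integral_indicator measurableSet_Ioo, ← integral_Ioc_eq_integral_Ioo,
        ← intervalIntegral.integral_of_le (B.height_mem y hy).1.le,
        intervalIntegral.integral_eq_sub_of_hasDerivAt (fun t _ => hd t)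
          (Continuous.intervalIntegrable (by fun_prop) _ _),
        hout (fr.incl y + B.lower • e) fun h => by
          have := h.2.1; rw [fr.inner_point] at this; exact this.false, sub_zero]
    · rw [indicator_of_notMem hy]
      refine integral_eq_zero_of_ae (ae_of_all _ fun t => ?_)
      have h0 : fderiv ℝ ψ (fr.incl y + t • e) = 0 :=
        hout' _ fun h => hy (by have := h.1; rwa [fr.proj_point] at this)
      simp [indicator, h0]
  have hνm : AEMeasurable (fun x => ENNReal.ofReal (inner ℝ (ν x) e))
      ((Measure.euclideanHausdorffMeasure n).restrict (S ∩ B.region)) := by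
    have := (hS.aestronglyMeasurable_normal.inner
      (aestronglyMeasurable_const (b := e))).aemeasurable.ennreal_ofReal
    exact this.mono_measure (Measure.restrict_mono inter_subset_left le_rfl)
  have hmeas := hS.isClosed.measurableSet.inter B.isOpen_region.measurableSet
  have hGm : AEMeasurable (fun y => fr.incl y + B.height y • e) (volume.restrict B.base) :=
    (fr.incl.continuous.continuousOn.add
      (B.continuousOn_height.smul continuousOn_const)).aemeasurable B.isOpen_base.measurableSet
  rw [hleft, ← integral_map hGm hψ.continuous.aestronglyMeasurable, B.map_volume hS,
    integral_withDensity_eq_integral_toReal_smul₀ hνm (ae_of_all _ fun _ => ENNReal.ofReal_lt_top)]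
  have hswap : ∫ x, ψ x * inner ℝ (ν x) e ∂surfaceMeasure S =
      ∫ x in S ∩ B.region, ψ x * inner ℝ (ν x) e ∂(Measure.euclideanHausdorffMeasure n) := by
    refine setIntegral_eq_of_subset_of_forall_sdiff_eq_zero hS.isClosed.measurableSet
      inter_subset_left fun x hx => ?_
    rw [hout x fun h => hx.2 ⟨hx.1, h⟩, zero_mul]
  rw [hswap]
  refine setIntegral_congr_fun hmeas fun x hx => ?_
  obtain ⟨hxS, hx1, hx2⟩ := hx
  have h := (B.mem_surface_iff _ hx1 _ hx2).1 (by rw [fr.decomp]; exact hxS)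
  have hpos := B.inner_normal_pos _ hx1
  rw [← h, fr.decomp] at hpos
  simp only [ENNReal.toReal_ofReal hpos.le, smul_eq_mul, mul_comm]

theorem integral_fderiv_eq_zero {d : ℕ} {ψ : Euc d → ℝ} (hψ : ContDiff ℝ 1 ψ)
    (hc : HasCompactSupport ψ) (v : Euc d) : ∫ x, fderiv ℝ ψ x v = 0 := by
  have := integral_mul_fderiv_eq_neg_fderiv_mul_of_integrable (μ := volume)
    (f := fun _ : Euc d => (1 : ℝ)) (g := ψ) (v := v) (by simp)
    (by
      simp only [one_mul]
      exact ((hψ.continuous_fderiv one_ne_zero).clm_apply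
        continuous_const).integrable_of_hasCompactSupport (hc.fderiv_apply ℝ v))
    (by simpa using hψ.continuous.integrable_of_hasCompactSupport hc)
    (fun x _ => by fun_prop) (fun x _ => hψ.differentiable one_ne_zero x)
  simpa using this

/-- The divergence theorem near a point. At a point of `S`, graph boxes give it for directions with
positive normal component, and every vector is a difference of two of these. -/
theorem IsInterface.exists_integral_fderiv_local {n : ℕ} {Ωi Ωo : Opens (Euc (n + 1))}
    {S : Set (Euc (n + 1))} {ν : Euc (n + 1) → Euc (n + 1)} (hS : IsInterface Ωi S Ωo ν)
    (x₀ v : Euc (n + 1)) :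
    ∃ U : Set (Euc (n + 1)), IsOpen U ∧ x₀ ∈ U ∧ ∀ ψ : Euc (n + 1) → ℝ, ContDiff ℝ 1 ψ →
      HasCompactSupport ψ → tsupport ψ ⊆ U →
      ∫ x in Ωi, fderiv ℝ ψ x v = ∫ x, ψ x * inner ℝ (ν x) v ∂surfaceMeasure S := by
  have hfin := hS.isLocallyFiniteMeasure
  -- away from the surface both sides vanish
  have hzeroS : ∀ ψ : Euc (n + 1) → ℝ, tsupport ψ ⊆ Sᶜ →
      ∫ x, ψ x * inner ℝ (ν x) v ∂surfaceMeasure S = 0 := by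
    intro ψ hψ
    refine setIntegral_eq_zero_of_forall_eq_zero fun x hx => ?_
    rw [image_eq_zero_of_notMem_tsupport fun h => hψ h hx, zero_mul]
  by_cases hx : x₀ ∈ S
  · -- in a direction with positive normal component
    have hdir : ∀ w : Euc (n + 1), 0 < inner ℝ (ν x₀) w →
        ∃ U : Set (Euc (n + 1)), IsOpen U ∧ x₀ ∈ U ∧ ∀ ψ : Euc (n + 1) → ℝ, ContDiff ℝ 1 ψ →
        HasCompactSupport ψ → tsupport ψ ⊆ U →
        ∫ x in Ωi, fderiv ℝ ψ x w = ∫ x, ψ x * inner ℝ (ν x) w ∂surfaceMeasure S := by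
      intro w hw
      have hw0 : w ≠ 0 := by rintro rfl; simp at hw
      have hwn := norm_pos_iff.2 hw0
      obtain ⟨fr⟩ := exists_frame (e := ‖w‖⁻¹ • w)
        (by rw [norm_smul, norm_inv, norm_norm, inv_mul_cancel₀ hwn.ne'])
      obtain ⟨B, hB⟩ := hS.exists_graphBox hx fr
        (by rw [real_inner_smul_right]; exact mul_pos (inv_pos.2 hwn) hw)
      refine ⟨B.region, B.isOpen_region, hB, fun ψ h1 h2 h3 => ?_⟩
      have h := B.integral_fderiv hS h1 h2 h3
      simp only [map_smul, smul_eq_mul, real_inner_smul_right, mul_left_comm _ ‖w‖⁻¹] at h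
      rw [integral_const_mul, integral_const_mul] at h
      exact mul_left_cancel₀ (inv_ne_zero hwn.ne') h
    -- `v = (v + (‖v‖ + 1) ν x₀) - (‖v‖ + 1) ν x₀`, a difference of two transversal vectors
    have hνν : inner ℝ (ν x₀) (ν x₀) = 1 := by
      rw [real_inner_self_eq_norm_sq, hS.norm_normal hx]; norm_num
    obtain ⟨U₁, hU₁, hx₁, h₁⟩ := hdir (ν x₀) (by rw [hνν]; norm_num)
    obtain ⟨U₂, hU₂, hx₂, h₂⟩ := hdir (v + (‖v‖ + 1) • ν x₀) (by
      rw [inner_add_right, real_inner_smul_right, hνν]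
      have := neg_le_of_abs_le (abs_real_inner_le_norm (ν x₀) v)
      rw [hS.norm_normal hx] at this
      linarith)
    refine ⟨U₁ ∩ U₂, hU₁.inter hU₂, ⟨hx₁, hx₂⟩, fun ψ hψ hc hsub => ?_⟩
    have e1 := h₁ ψ hψ hc (hsub.trans inter_subset_left)
    have e2 := h₂ ψ hψ hc (hsub.trans inter_subset_right)
    have hcd : ∀ w, IntegrableOn (fun x => fderiv ℝ ψ x w) Ωi := fun w =>
      (((hψ.continuous_fderiv one_ne_zero).clm_apply
        continuous_const).integrable_of_hasCompactSupport (hc.fderiv_apply ℝ w)).integrableOn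
    have hsd : ∀ w, Integrable (fun x => ψ x * inner ℝ (ν x) w) (surfaceMeasure S) :=
      hS.integrable_mul_inner_normal (hψ.continuous.integrable_of_hasCompactSupport hc)
    simp only [map_add, map_smul, smul_eq_mul, inner_add_right, real_inner_smul_right, mul_add,
      mul_left_comm _ (‖v‖ + 1)] at e2
    rw [integral_add (hcd _) ((hcd _).const_mul _), integral_add (hsd _) ((hsd _).const_mul _),
      integral_const_mul, integral_const_mul, e1] at e2
    exact add_right_cancel e2
  · have hcov : x₀ ∈ (Ωi : Set (Euc (n + 1))) ∪ Ωo := by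
      rw [hS.eq_compl] at hx; exact not_not.1 hx
    rcases hcov with hi | ho
    · refine ⟨Ωi, Ωi.isOpen, hi, fun ψ hψ hc hsub => ?_⟩
      rw [hzeroS ψ (hsub.trans (Set.disjoint_left.1 hS.disjoint_left)),
        setIntegral_eq_integral_of_forall_compl_eq_zero]
      · exact integral_fderiv_eq_zero hψ hc v
      · intro x hx
        rw [image_eq_zero_of_notMem_tsupport (f := fderiv ℝ ψ)
          fun h => hx (hsub (tsupport_fderiv_subset ℝ h))]
        simp
    · refine ⟨Ωo, Ωo.isOpen, ho, fun ψ hψ hc hsub => ?_⟩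
      rw [hzeroS ψ (hsub.trans (Set.disjoint_right.1 hS.disjoint_right))]
      refine setIntegral_eq_zero_of_forall_eq_zero fun x hx => ?_
      rw [image_eq_zero_of_notMem_tsupport (f := fderiv ℝ ψ) fun h =>
          Set.disjoint_left.1 hS.disjoint_sides hx (hsub (tsupport_fderiv_subset ℝ h))]
      simp

/-- The divergence theorem on `Ωi` for the vector field `ψ v`, with `v` constant, by a partition of
unity. -/
theorem IsInterface.setIntegral_inside_fderiv {n : ℕ} {Ωi Ωo : Opens (Euc (n + 1))}
    {S : Set (Euc (n + 1))} {ν : Euc (n + 1) → Euc (n + 1)} (hS : IsInterface Ωi S Ωo ν)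
    {ψ : Euc (n + 1) → ℝ} (hψ : ContDiff ℝ 1 ψ) (hc : HasCompactSupport ψ) (v : Euc (n + 1)) :
    ∫ x in Ωi, fderiv ℝ ψ x v = ∫ x, ψ x * inner ℝ (ν x) v ∂surfaceMeasure S := by
  have hfin := hS.isLocallyFiniteMeasure
  choose U hU hxU hUψ using fun x => hS.exists_integral_fderiv_local x v
  obtain ⟨t, ht⟩ := hc.isCompact.elim_finite_subcover U hU
    fun x _ => mem_iUnion.2 ⟨x, hxU x⟩
  obtain ⟨f, hf⟩ := SmoothPartitionOfUnity.exists_isSubordinate (modelWithCornersSelf ℝ (Euc (n +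
      1)))
    (isClosed_tsupport ψ) (fun i : t => U i) (fun i => hU i) (by simpa [iUnion_subtype] using ht)
  have hfd : ∀ i, ContDiff ℝ 1 (f i) := fun i => (f i).contMDiff.contDiff.of_le (by simp)
  have hsum : ψ = fun x => ∑ i, f i x * ψ x := by
    ext x
    by_cases hx : x ∈ tsupport ψ
    · have := f.sum_eq_one hx
      rw [finsum_eq_sum_of_fintype] at this
      rw [← Finset.sum_mul, this, one_mul]
    · simp [image_eq_zero_of_notMem_tsupport hx]
  have hpd : ∀ i, ContDiff ℝ 1 fun x => f i x * ψ x := fun i => (hfd i).mul hψ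
  have hpc : ∀ i, HasCompactSupport fun x => f i x * ψ x := fun i => hc.mul_left
  have hloc : ∀ i, ∫ x in Ωi, fderiv ℝ (fun x => f i x * ψ x) x v =
      ∫ x, f i x * ψ x * inner ℝ (ν x) v ∂surfaceMeasure S := fun i =>
    hUψ i _ (hpd i) (hpc i) (tsupport_mul_subset_left.trans (hf i))
  have hder : ∀ x, fderiv ℝ ψ x v = ∑ i, fderiv ℝ (fun x => f i x * ψ x) x v := by
    intro x
    conv_lhs => rw [hsum]
    rw [fderiv_fun_sum fun i _ => (hpd i).differentiable one_ne_zero x]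
    simp
  have hmul : ∀ x, ψ x * inner ℝ (ν x) v = ∑ i, f i x * ψ x * inner ℝ (ν x) v := by
    intro x
    conv_lhs => rw [hsum]
    rw [Finset.sum_mul]
  simp only [hder, hmul]
  rw [integral_finsetSum, integral_finsetSum]
  · exact Finset.sum_congr rfl fun i _ => hloc i
  · exact fun i _ => hS.integrable_mul_inner_normal
      ((hpd i).continuous.integrable_of_hasCompactSupport (hpc i)) v
  · exact fun i _ => ((((hpd i).continuous_fderiv one_ne_zero).clm_apply
        continuous_const).integrable_of_hasCompactSupport ((hpc i).fderiv_apply ℝ v)).integrableOn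

theorem IsInterface.setIntegral_add_setIntegral {n : ℕ} {Ωi Ωo : Opens (Euc (n + 1))}
    {S : Set (Euc (n + 1))} {ν : Euc (n + 1) → Euc (n + 1)} (hS : IsInterface Ωi S Ωo ν)
    {f : Euc (n + 1) → ℝ} (hf : IntegrableOn f Ωi) (hf' : IntegrableOn f Ωo) :
    (∫ x in Ωi, f x) + ∫ x in Ωo, f x = ∫ x, f x := by
  rw [← setIntegral_union hS.disjoint_sides Ωo.isOpen.measurableSet hf hf',
    ← setIntegral_univ (f := f) (μ := volume)]
  refine setIntegral_congr_set ?_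
  rw [ae_eq_univ, ← hS.eq_compl]
  exact hS.volume_eq_zero

/-- The divergence theorem on `Ωo`, where `ν` is the inner normal. It follows from the one on `Ωi`,
as the integral over all of space vanishes. -/
theorem IsInterface.setIntegral_outside_fderiv {n : ℕ} {Ωi Ωo : Opens (Euc (n + 1))}
    {S : Set (Euc (n + 1))} {ν : Euc (n + 1) → Euc (n + 1)} (hS : IsInterface Ωi S Ωo ν)
    {ψ : Euc (n + 1) → ℝ} (hψ : ContDiff ℝ 1 ψ) (hc : HasCompactSupport ψ) (v : Euc (n + 1)) :
    ∫ x in Ωo, fderiv ℝ ψ x v = -∫ x, ψ x * inner ℝ (ν x) v ∂surfaceMeasure S := by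
  have hint : Integrable fun x => fderiv ℝ ψ x v :=
    ((hψ.continuous_fderiv one_ne_zero).clm_apply
      continuous_const).integrable_of_hasCompactSupport (hc.fderiv_apply ℝ v)
  have h := hS.setIntegral_add_setIntegral hint.integrableOn hint.integrableOn
  rw [integral_fderiv_eq_zero hψ hc, hS.setIntegral_inside_fderiv hψ hc] at h
  linarith

/-! ### Distributions given by functions -/

theorem coe_lineDerivOp {d : ℕ} {Ω : Opens (Euc d)} (v : Euc d) (ψ : 𝓓(Ω, ℝ)) :
    (⇑(∂_{v} ψ : 𝓓(Ω, ℝ)) : Euc d → ℝ) = fun x => fderiv ℝ (ψ : Euc d → ℝ) x v := by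
  ext x
  rw [TestFunction.lineDerivOp_eq_lineDerivCLM ℝ, TestFunction.lineDerivCLM_apply_of_le (by simp)]
  exact (ψ.contDiff.differentiable (by simp) x).lineDeriv_eq_fderiv

theorem distOfDensity_apply {d : ℕ} {Ω : Opens (Euc d)} {μ : Measure (Euc d)} {u : Euc d → ℝ}
    (hu : LocallyIntegrableOn u Ω μ) (ψ : 𝓓(Ω, ℝ)) :
    distOfDensity Ω μ u ψ = ∫ x, ψ x * u x ∂μ := by
  exact TestFunction.integralAgainstBilinCLM_eq_integral (B := ContinuousLinearMap.mul ℝ ℝ) hu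

theorem distOfFun_apply {d : ℕ} {Ω : Opens (Euc d)} {u : Euc d → ℝ}
    (hu : LocallyIntegrableOn u Ω) (ψ : 𝓓(Ω, ℝ)) :
    distOfFun Ω u ψ = ∫ x, ψ x * u x :=
  distOfDensity_apply hu ψ

theorem lineDeriv_dist_apply {d : ℕ} {Ω : Opens (Euc d)} (T : 𝓓'(Ω, ℝ)) (v : Euc d) (ψ : 𝓓(Ω, ℝ)) :
    (∂_{v} T) ψ = -T (∂_{v} ψ) := by
  rw [Distribution.lineDerivOp_apply_apply, map_neg]

theorem laplacian_eq_sum {d : ℕ} {f : Euc d → ℝ} {x : Euc d} (hf : ContDiffAt ℝ 2 f x) :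
    Laplacian.laplacian f x =
      ∑ j, fderiv ℝ (fun y => fderiv ℝ f y (stdVec j)) x (stdVec j) := by
  rw [InnerProductSpace.laplacian_eq_iteratedFDeriv_orthonormalBasis f
    (EuclideanSpace.basisFun (Fin d) ℝ)]
  refine Finset.sum_congr rfl fun j _ => ?_
  have h1 : DifferentiableAt ℝ (fderiv ℝ f) x :=
    (hf.fderiv_right (m := 1) (by norm_num)).differentiableAt one_ne_zero
  rw [iteratedFDeriv_two_apply, fderiv_clm_apply h1 (differentiableAt_const _)]
  simp [stdVec]

theorem distLaplacian_apply {d : ℕ} {Ω : Opens (Euc d)} (T : 𝓓'(Ω, ℝ)) (ψ : 𝓓(Ω, ℝ)) :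
    distLaplacian T ψ = ∑ j : Fin d, T (∂_{stdVec j} (∂_{stdVec j} ψ)) := by
  unfold distLaplacian
  simp

theorem distLaplacian_distOfFun_apply {d : ℕ} {Ω : Opens (Euc d)} {u : Euc d → ℝ}
    (hu : LocallyIntegrableOn u Ω) (ψ : 𝓓(Ω, ℝ)) :
    distLaplacian (distOfFun Ω u) ψ =
      ∫ x, Laplacian.laplacian (ψ : Euc d → ℝ) x * u x := by
  have hψ : ∀ x, ContDiffAt ℝ 2 (ψ : Euc d → ℝ) x := fun x =>
    (ψ.contDiff.of_le ENat.LEInfty.out).contDiffAt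
  simp only [distLaplacian_apply, distOfFun_apply hu, laplacian_eq_sum (hψ _), Finset.sum_mul]
  rw [integral_finsetSum]
  · simp only [coe_lineDerivOp]
  · intro j _
    have := TestFunction.integrable_bilin (ContinuousLinearMap.mul ℝ ℝ) hu
      (∂_{stdVec j} (∂_{stdVec j} ψ) : 𝓓(Ω, ℝ))
    simpa only [coe_lineDerivOp, ContinuousLinearMap.mul_apply'] using this

/-! ### Weyl's lemma -/

/-- A smooth radial function, nonnegative and supported in the closed unit ball. It is not
normalised. -/
noncomputable def radialBump {d : ℕ} (y : Euc d) : ℝ := Real.smoothTransition (1 - ‖y‖ ^ 2)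

/-- The compactly supported radial potential of the vector field `-radialBump y • y`, an integral of
the profile of `radialBump` in the variable `‖y‖ ^ 2`. -/
noncomputable def radialPotential {d : ℕ} (y : Euc d) : ℝ :=
  2⁻¹ * ∫ t in (‖y‖ ^ 2)..1, Real.smoothTransition (1 - t)

theorem contDiff_radialBump {d : ℕ} : ContDiff ℝ ∞ (radialBump (d := d)) :=
  Real.smoothTransition.contDiff.comp (contDiff_const.sub (contDiff_norm_sq ℝ))

theorem hasDerivAt_integral_smoothTransition (s : ℝ) :
    HasDerivAt (fun s : ℝ => ∫ t in s..1, Real.smoothTransition (1 - t))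
      (-Real.smoothTransition (1 - s)) s := by
  have hc : Continuous fun t : ℝ => Real.smoothTransition (1 - t) :=
    Real.smoothTransition.continuous.comp (by fun_prop)
  exact intervalIntegral.integral_hasDerivAt_left (hc.intervalIntegrable _ _)
    (hc.stronglyMeasurableAtFilter _ _) hc.continuousAt

theorem contDiff_radialPotential {d : ℕ} : ContDiff ℝ ∞ (radialPotential (d := d)) := by
  have h : ContDiff ℝ ∞ (fun s : ℝ => ∫ t in s..1, Real.smoothTransition (1 - t)) := by
    refine contDiff_infty_iff_deriv.2
      ⟨fun s => (hasDerivAt_integral_smoothTransition s).differentiableAt, ?_⟩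
    have : deriv (fun s : ℝ => ∫ t in s..1, Real.smoothTransition (1 - t)) =
        fun s => -Real.smoothTransition (1 - s) :=
      funext fun s => (hasDerivAt_integral_smoothTransition s).deriv
    rw [this]
    exact (Real.smoothTransition.contDiff.comp (contDiff_const.sub contDiff_id)).neg
  exact contDiff_const.mul (h.comp (contDiff_norm_sq ℝ))

theorem radialBump_eq_zero {d : ℕ} {y : Euc d} (hy : 1 ≤ ‖y‖) : radialBump y = 0 :=
  Real.smoothTransition.zero_of_nonpos (by nlinarith)

theorem radialPotential_eq_zero {d : ℕ} {y : Euc d} (hy : 1 ≤ ‖y‖) : radialPotential y = 0 := by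
  have h1 : (1 : ℝ) ≤ ‖y‖ ^ 2 := by nlinarith
  rw [radialPotential, intervalIntegral.integral_zero_ae, mul_zero]
  refine ae_of_all _ fun t ht => Real.smoothTransition.zero_of_nonpos ?_
  rw [uIoc_of_ge h1] at ht
  linarith [ht.1]

theorem hasCompactSupport_radialBump {d : ℕ} : HasCompactSupport (radialBump (d := d)) :=
  HasCompactSupport.intro (isCompact_closedBall 0 1) fun y hy =>
    radialBump_eq_zero (by simpa using (not_le.1 fun h => hy (by simpa using h)).le)

theorem hasCompactSupport_radialPotential {d : ℕ} : HasCompactSupport (radialPotential (d := d)) :=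
  HasCompactSupport.intro (isCompact_closedBall 0 1) fun y hy =>
    radialPotential_eq_zero (by simpa using (not_le.1 fun h => hy (by simpa using h)).le)

theorem fderiv_radialPotential {d : ℕ} (y v : Euc d) :
    fderiv ℝ radialPotential y v = -(radialBump y * inner ℝ y v) := by
  have h1 := (hasFDerivAt_id (𝕜 := ℝ) y).norm_sq
  have h2 := ((hasDerivAt_integral_smoothTransition (‖y‖ ^ 2)).const_mul 2⁻¹).comp_hasFDerivAt y h1
  change fderiv ℝ ((fun s : ℝ => 2⁻¹ * ∫ t in s..1, Real.smoothTransition (1 - t)) ∘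
    fun y : Euc d => ‖id y‖ ^ 2) y v = _
  rw [h2.fderiv]
  simp [radialBump]
  ring

/-- The Laplacian of the potential is minus the generator of dilations `d + y · ∇` applied to
`radialBump`. The change of a mollifier with its scale is therefore the Laplacian of a test
function. -/
theorem laplacian_radialPotential {d : ℕ} (y : Euc d) :
    Laplacian.laplacian radialPotential y = -(d * radialBump y + fderiv ℝ radialBump y y) := by
  have hC : ContDiff ℝ 2 (radialPotential (d := d)) :=
    contDiff_radialPotential.of_le ENat.LEInfty.out
  rw [laplacian_eq_sum hC.contDiffAt]
  simp only [fderiv_radialPotential]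
  have hb : DifferentiableAt ℝ radialBump y := contDiff_radialBump.differentiable (by simp) y
  have hterm : ∀ j : Fin d, fderiv ℝ (fun z : Euc d => -(radialBump z * inner ℝ z (stdVec j))) y
      (stdVec j) = -(radialBump y + y j * fderiv ℝ radialBump y (stdVec j)) := by
    intro j
    have h1 : DifferentiableAt ℝ (fun z : Euc d => inner ℝ z (stdVec j)) y :=
      differentiableAt_fun_id.inner ℝ (differentiableAt_const _)
    rw [fderiv_fun_neg, fderiv_fun_mul hb h1]
    have h2 : fderiv ℝ (fun z : Euc d => inner ℝ z (stdVec j)) y (stdVec j) = 1 := by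
      rw [fderiv_inner_apply ℝ differentiableAt_fun_id (differentiableAt_const _)]
      simp [stdVec]
    have h3 : inner ℝ y (stdVec j) = y j := by simp [stdVec, EuclideanSpace.inner_single_right]
    simp [h2, h3]
  simp only [hterm, Finset.sum_neg_distrib, Finset.sum_add_distrib]
  have hy : y = ∑ j, y j • stdVec j := by
    have := (EuclideanSpace.basisFun (Fin d) ℝ).sum_repr y
    simpa [stdVec] using this.symm
  have : fderiv ℝ radialBump y y = ∑ j, y j * fderiv ℝ radialBump y (stdVec j) := by
    conv_lhs => rw [congrArg (fderiv ℝ radialBump y) hy]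
    simp
  rw [this]
  simp

theorem laplacian_eq_zero_of_notMem_tsupport {d : ℕ} {f : Euc d → ℝ} {x : Euc d}
    (hx : x ∉ tsupport f) : Laplacian.laplacian f x = 0 := by
  have h : f =ᶠ[𝓝 x] fun _ => (0 : ℝ) := notMem_tsupport_iff_eventuallyEq.1 hx
  rw [(InnerProductSpace.laplacian_congr_nhds h).self_of_nhds]
  simp

theorem continuous_laplacian {d : ℕ} {f : Euc d → ℝ} (hf : ContDiff ℝ 2 f) :
    Continuous (Laplacian.laplacian f) := by
  have : Laplacian.laplacian f =
      fun x => ∑ j, fderiv ℝ (fun y => fderiv ℝ f y (stdVec j)) x (stdVec j) :=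
    funext fun x => laplacian_eq_sum hf.contDiffAt
  rw [this]
  refine continuous_finsetSum _ fun j _ => ?_
  have h1 : ContDiff ℝ 1 fun y => fderiv ℝ f y (stdVec j) :=
    (hf.fderiv_right (m := 1) (by norm_num)).clm_apply contDiff_const
  exact (h1.continuous_fderiv one_ne_zero).clm_apply continuous_const

theorem hasCompactSupport_laplacian {d : ℕ} {f : Euc d → ℝ} (hf : HasCompactSupport f) :
    HasCompactSupport (Laplacian.laplacian f) :=
  HasCompactSupport.intro hf.isCompact fun _ hx => laplacian_eq_zero_of_notMem_tsupport hx

theorem laplacian_comp_smul_sub {d : ℕ} {f : Euc d → ℝ} (hf : ContDiff ℝ 2 f) (s : ℝ)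
    (x z : Euc d) :
    Laplacian.laplacian (fun z => f (s • (x - z))) z =
        s ^ 2 * Laplacian.laplacian f (s • (x - z)) := by
  have hin : ∀ z : Euc d, HasFDerivAt (fun z : Euc d => s • (x - z))
      (s • (-(ContinuousLinearMap.id ℝ (Euc d)))) z := fun z =>
    ((hasFDerivAt_id z).const_sub x).const_smul s
  have h1 : ∀ g : Euc d → ℝ, Differentiable ℝ g → ∀ z v,
      fderiv ℝ (fun z => g (s • (x - z))) z v = -s * fderiv ℝ g (s • (x - z)) v := by
    intro g hg z v
    have := ((hg (s • (x - z))).hasFDerivAt).comp z (hin z)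
    change fderiv ℝ (g ∘ fun z => s • (x - z)) z v = _
    rw [this.fderiv]
    simp
  have hcomp : ContDiff ℝ 2 fun z => f (s • (x - z)) :=
    hf.comp (by fun_prop)
  rw [laplacian_eq_sum hcomp.contDiffAt, laplacian_eq_sum hf.contDiffAt, Finset.mul_sum]
  refine Finset.sum_congr rfl fun j _ => ?_
  have hd : Differentiable ℝ fun y => fderiv ℝ f y (stdVec j) :=
    ((hf.fderiv_right (m := 1) (by norm_num)).clm_apply contDiff_const).differentiable one_ne_zero
  simp only [h1 f (hf.differentiable two_ne_zero)]
  have hd2 : DifferentiableAt ℝ (fun z => fderiv ℝ f (s • (x - z)) (stdVec j)) z :=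
    (hd _).comp z (hin z).differentiableAt
  rw [fderiv_const_mul hd2]
  rw [smul_apply, h1 _ hd, smul_eq_mul]
  ring

/-- Changing the scale of the mollifier `s ^ d radialBump (s y)` changes it by a Laplacian. -/
theorem hasDerivAt_scaled_radialBump {d : ℕ} (y : Euc d) {s : ℝ} (hs : s ≠ 0) :
    HasDerivAt (fun s : ℝ => s ^ d * radialBump (s • y))
      (-(s ^ d * s⁻¹ * Laplacian.laplacian radialPotential (s • y))) s := by
  have h1 : HasDerivAt (fun s : ℝ => s • y) y s := by
    simpa using (hasDerivAt_id s).smul_const y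
  have h2 := ((contDiff_radialBump.differentiable (by simp)
      (s • y)).hasFDerivAt).comp_hasDerivAt s h1
  have h3 := (hasDerivAt_pow d s).mul h2
  refine h3.congr_deriv ?_
  rw [laplacian_radialPotential, map_smul, smul_eq_mul]
  have hp : (d : ℝ) * s ^ (d - 1) = d * (s ^ d * s⁻¹) := by
    rcases d with _ | d
    · simp
    · rw [Nat.add_sub_cancel, pow_succ, mul_assoc, mul_inv_cancel₀ hs, mul_one]
  simp only [Function.comp_apply]
  rw [hp]
  field_simp

section Weyl

variable {d : ℕ} {u : Euc d → ℝ}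

/-- The radial means of a weakly harmonic function do not change with the scale. -/
theorem hasDerivAt_integral_scaled_radialBump (hu : LocallyIntegrable u)
    (h : ∀ χ : Euc d → ℝ, ContDiff ℝ ∞ χ → HasCompactSupport χ →
      ∫ z, Laplacian.laplacian χ z * u z = 0) (x : Euc d) {s₀ : ℝ} (hs₀ : 0 < s₀) :
    HasDerivAt (fun s : ℝ => ∫ z, s ^ d * radialBump (s • (x - z)) * u z) 0 s₀ := by
  have hP2 : ContDiff ℝ 2 (radialPotential (d := d)) :=
    contDiff_radialPotential.of_le ENat.LEInfty.out
  have hLc := continuous_laplacian hP2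
  obtain ⟨M, hM⟩ := hLc.bounded_above_of_compact_support
    (hasCompactSupport_laplacian hasCompactSupport_radialPotential)
  have hM0 : 0 ≤ M := (norm_nonneg _).trans (hM 0)
  set C := (2 * s₀) ^ d * (s₀ / 2)⁻¹ * M with hC
  have hmeasu : AEStronglyMeasurable u := hu.aestronglyMeasurable
  have hint : ∀ f : Euc d → ℝ, ContDiff ℝ 2 f → HasCompactSupport f →
      HasCompactSupport fun z => f (s₀ • (x - z)) := by
    intro f _ hf
    exact hf.comp_homeomorph ((Homeomorph.subLeft x).trans (Homeomorph.smulOfNeZero s₀ hs₀.ne'))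
  have hmain := hasDerivAt_integral_of_dominated_loc_of_deriv_le (μ := volume)
    (F := fun (s : ℝ) z => s ^ d * radialBump (s • (x - z)) * u z)
    (F' := fun (s : ℝ) z => -(s ^ d * s⁻¹ * Laplacian.laplacian radialPotential (s • (x - z))) *
        u z)
    (bound := (Metric.closedBall x (2 / s₀)).indicator fun z => C * ‖u z‖)
    (x₀ := s₀) (s := Ioo (s₀ / 2) (2 * s₀)) (Ioo_mem_nhds (by linarith) (by linarith))
        ?_ ?_ ?_ ?_ ?_ ?_
  -- the derivative integrates to zero, as it is the Laplacian of a test function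
  · have hz : ∫ z, -(s₀ ^ d * s₀⁻¹ * Laplacian.laplacian radialPotential (s₀ • (x - z)))
      * u z = 0 := by
      have h0 := h (fun z => radialPotential (s₀ • (x - z)))
        (contDiff_radialPotential.comp (by fun_prop))
        (hint _ hP2 hasCompactSupport_radialPotential)
      simp only [laplacian_comp_smul_sub hP2] at h0
      have hrw : ∀ z, -(s₀ ^ d * s₀⁻¹ * Laplacian.laplacian radialPotential (s₀ • (x - z))) * u z =
          -(s₀ ^ d * s₀⁻¹ * (s₀ ^ 2)⁻¹) *
            (s₀ ^ 2 * Laplacian.laplacian radialPotential (s₀ • (x - z)) * u z) := by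
        intro z; field_simp
      simp only [hrw]
      rw [integral_const_mul, h0, mul_zero]
    have := hmain.2
    rwa [hz] at this
  · refine Eventually.of_forall fun s => AEStronglyMeasurable.mul ?_ hmeasu
    have : Continuous fun z => s ^ d * radialBump (s • (x - z)) :=
      continuous_const.mul (contDiff_radialBump.continuous.comp (by fun_prop))
    exact this.aestronglyMeasurable
  · have hc : Continuous fun z => s₀ ^ d * radialBump (s₀ • (x - z)) :=
      continuous_const.mul (contDiff_radialBump.continuous.comp (by fun_prop))
    have hs : HasCompactSupport fun z => s₀ ^ d * radialBump (s₀ • (x - z)) :=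
      (hint _ (contDiff_radialBump.of_le ENat.LEInfty.out) hasCompactSupport_radialBump).mul_left
    simpa using hu.integrable_smul_left_of_hasCompactSupport hc hs
  · refine AEStronglyMeasurable.mul ?_ hmeasu
    have : Continuous fun z => -(s₀ ^ d * s₀⁻¹ * Laplacian.laplacian radialPotential (s₀ • (x -
        z))) :=
      (continuous_const.mul (hLc.comp (by fun_prop))).neg
    exact this.aestronglyMeasurable
  · refine ae_of_all _ fun z s hs => ?_
    have hs1 : 0 < s := by linarith [hs.1]
    by_cases hz : z ∈ Metric.closedBall x (2 / s₀)
    · rw [indicator_of_mem hz, norm_mul, norm_neg, norm_mul, norm_mul]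
      have e1 : ‖s ^ d‖ ≤ (2 * s₀) ^ d := by
        rw [norm_pow, Real.norm_of_nonneg hs1.le]
        exact pow_le_pow_left₀ hs1.le hs.2.le d
      have e2 : ‖s⁻¹‖ ≤ (s₀ / 2)⁻¹ := by
        rw [Real.norm_of_nonneg (inv_nonneg.2 hs1.le)]
        exact inv_anti₀ (by linarith) hs.1.le
      have e3 := hM (s • (x - z))
      rw [hC]
      gcongr
    · rw [indicator_of_notMem hz]
      have hfar : s • (x - z) ∉ tsupport (radialPotential (d := d)) := by
        intro hmem
        have hsub : tsupport (radialPotential (d := d)) ⊆ Metric.closedBall 0 1 :=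
          closure_minimal (fun y hy => by
            by_contra hcon
            exact hy (radialPotential_eq_zero (not_le.1 fun h => hcon (by simpa using h)).le))
            Metric.isClosed_closedBall
        have h1 := hsub hmem
        rw [mem_closedBall_zero_iff, norm_smul, Real.norm_of_nonneg hs1.le] at h1
        rw [Metric.mem_closedBall, dist_comm, dist_eq_norm, not_le, div_lt_iff₀ hs₀] at hz
        nlinarith [hs.1, norm_nonneg (x - z)]
      rw [laplacian_eq_zero_of_notMem_tsupport hfar]
      simp
  · rw [integrable_indicator_iff Metric.isClosed_closedBall.measurableSet]
    exact ((hu.integrableOn_isCompact (isCompact_closedBall _ _)).norm).const_mul C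
  · refine ae_of_all _ fun z s hs => ?_
    exact (hasDerivAt_scaled_radialBump (x - z) (by linarith [hs.1] : (0:ℝ)
        < s).ne').mul_const (u z)

theorem integral_scaled_radialBump_eq (hu : LocallyIntegrable u)
    (h : ∀ χ : Euc d → ℝ, ContDiff ℝ ∞ χ → HasCompactSupport χ →
      ∫ z, Laplacian.laplacian χ z * u z = 0) (x : Euc d) {s : ℝ} (hs : 0 < s) :
    ∫ z, s ^ d * radialBump (s • (x - z)) * u z = ∫ z, radialBump (x - z) * u z := by
  have hd := fun s (hs : 0 < s) => hasDerivAt_integral_scaled_radialBump hu h x hs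
  have := isOpen_Ioi.is_const_of_deriv_eq_zero (isPreconnected_Ioi (a := (0 : ℝ)))
    (fun s hs => (hd s hs).differentiableAt.differentiableWithinAt) (fun s hs => (hd s hs).deriv)
    (mem_Ioi.2 hs) (mem_Ioi.2 one_pos)
  simpa using this

theorem integral_radialBump_pos : 0 < ∫ y : Euc d, radialBump y :=
  contDiff_radialBump.continuous.integral_pos_of_hasCompactSupport_nonneg_nonzero (x := 0)
    hasCompactSupport_radialBump (fun _ => Real.smoothTransition.nonneg _)
    (by simp [radialBump])

/-- As the scale shrinks, the normalised radial means converge at the Lebesgue points. -/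
theorem ae_tendsto_integral_scaled_radialBump (hu : LocallyIntegrable u) :
    ∀ᵐ x, Tendsto (fun s : ℝ => ∫ z, ((∫ y : Euc d, radialBump y)⁻¹ *
      (s ^ d * radialBump (s • (x - z)))) • u z) atTop (𝓝 (u x)) := by
  set c := ∫ y : Euc d, radialBump y with hc
  have hc0 : 0 < c := integral_radialBump_pos
  filter_upwards [(Besicovitch.vitaliFamily volume).ae_tendsto_average_norm_sub hu] with x hx
  have h1 := (hx.comp (Besicovitch.tendsto_filterAt volume x)).comp
    (tendsto_inv_atTop_nhdsGT_zero (𝕜 := ℝ))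
  refine tendsto_integral_smul_of_tendsto_average_norm_sub
    (c⁻¹ * volume.real (Metric.closedBall (0 : Euc d) 1)) h1 ?_ ?_ ?_ ?_
  · exact Eventually.of_forall fun s => hu.integrableOn_isCompact (isCompact_closedBall _ _)
  · refine tendsto_const_nhds.congr' ?_
    filter_upwards [eventually_gt_atTop (0 : ℝ)] with s hs
    rw [integral_const_mul, integral_const_mul,
      integral_sub_left_eq_self (fun z : Euc d => radialBump (s • z)) volume x,
      Measure.integral_comp_smul, finrank_euclideanSpace, Fintype.card_fin, ← hc, smul_eq_mul,
      abs_of_pos (by positivity)]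
    field_simp
  · filter_upwards [eventually_gt_atTop (0 : ℝ)] with s hs z hz
    by_contra hcon
    refine hz ?_
    have h2 : 1 ≤ ‖s • (x - z)‖ := by
      rw [norm_smul, Real.norm_of_nonneg hs.le]
      simp only [Metric.mem_closedBall, not_le, dist_comm z x,
        dist_eq_norm] at hcon
      rw [inv_lt_iff_one_lt_mul₀ hs] at hcon
      linarith
    simp [radialBump_eq_zero h2]
  · filter_upwards [eventually_gt_atTop (0 : ℝ)] with s hs z
    have hb1 : radialBump (s • (x - z)) ≤ 1 := Real.smoothTransition.le_one _
    have hb0 : 0 ≤ radialBump (s • (x - z)) := Real.smoothTransition.nonneg _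
    have hvol : 0 < volume.real (Metric.closedBall (0 : Euc d) 1) :=
      ENNReal.toReal_pos (Metric.measure_closedBall_pos _ _ one_pos).ne'
        (isCompact_closedBall _ _).measure_lt_top.ne
    have hball : volume.real (Metric.closedBall x s⁻¹) =
        (s ^ d)⁻¹ * volume.real (Metric.closedBall (0 : Euc d) 1) := by
      rw [Measure.addHaar_real_closedBall' _ _ (inv_nonneg.2 hs.le), finrank_euclideanSpace,
        Fintype.card_fin, inv_pow]
    change |c⁻¹ * (s ^ d * radialBump (s • (x - z)))| ≤
      c⁻¹ * volume.real (Metric.closedBall (0 : Euc d) 1) / volume.real (Metric.closedBall x s⁻¹)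
    rw [hball, mul_div_mul_right _ _ hvol.ne', div_inv_eq_mul,
      abs_of_nonneg (mul_nonneg (inv_nonneg.2 hc0.le) (mul_nonneg (pow_nonneg hs.le d) hb0))]
    exact mul_le_mul_of_nonneg_left (mul_le_of_le_one_right (pow_nonneg hs.le d) hb1)
      (inv_nonneg.2 hc0.le)

/-- A derivative of a convolution may be taken on the smooth factor. -/
theorem fderiv_convolution_apply {f : Euc d → ℝ} (hf : ContDiff ℝ 1 f) (hc : HasCompactSupport f)
    (hu : LocallyIntegrable u) (x v : Euc d) :
    fderiv ℝ (convolution f u (ContinuousLinearMap.mul ℝ ℝ) volume) x v =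
      convolution (fun y => fderiv ℝ f y v) u (ContinuousLinearMap.mul ℝ ℝ) volume x := by
  rw [(hc.hasFDerivAt_convolution_left (ContinuousLinearMap.mul ℝ ℝ) hf hu x).fderiv,
    convolution_eq_swap, convolution_eq_swap]
  rw [ContinuousLinearMap.integral_apply]
  · rfl
  · exact ((hc.fderiv ℝ).convolutionExists_left (ContinuousLinearMap.precompL (Euc d)
      (ContinuousLinearMap.mul ℝ ℝ)) (hf.continuous_fderiv one_ne_zero) hu x).integrable_swap

/-- Weyl's lemma on `ℝ^d`: a weakly harmonic function equals almost everywhere its radial mean of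
scale one, since the radial means do not depend on the scale. That mean is smooth, and harmonic
because the Laplacian falls on the mollifier. -/
theorem isGloballyHarmonic_of_integral_laplacian_eq_zero (hu : LocallyIntegrable u)
    (h : ∀ χ : Euc d → ℝ, ContDiff ℝ ∞ χ → HasCompactSupport χ →
      ∫ z, Laplacian.laplacian χ z * u z = 0) : IsGloballyHarmonic u := by
  set c := ∫ y : Euc d, radialBump y with hc
  set H := convolution radialBump u (ContinuousLinearMap.mul ℝ ℝ) volume with hH
  have hHs : ContDiff ℝ ∞ H :=
    hasCompactSupport_radialBump.contDiff_convolution_left _ contDiff_radialBump hu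
  have hH2 : ContDiff ℝ 2 H := hHs.of_le ENat.LEInfty.out
  have hb2 : ContDiff ℝ 2 (radialBump (d := d)) := contDiff_radialBump.of_le ENat.LEInfty.out
  have hHval : ∀ x, H x = ∫ z, radialBump (x - z) * u z := fun x => by
    rw [hH, convolution_eq_swap]; rfl
  have hHlap : ∀ x, Laplacian.laplacian H x = 0 := by
    intro x
    have hshift : ContDiff ℝ ∞ fun z => radialBump (x - z) :=
      contDiff_radialBump.comp (contDiff_const.sub contDiff_id)
    have h0 := h (fun z => radialBump (x - z)) hshift
      (hasCompactSupport_radialBump.comp_homeomorph (Homeomorph.subLeft x))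
    have h1 := fun z => laplacian_comp_smul_sub hb2 1 x z
    simp only [one_smul, one_pow, one_mul] at h1
    simp only [h1] at h0
    have hd1 : ∀ j : Fin d, ContDiff ℝ 1 fun y : Euc d => fderiv ℝ radialBump y (stdVec j)
        := fun j =>
      (hb2.fderiv_right (m := 1) (by norm_num)).clm_apply contDiff_const
    have hcs : ∀ j : Fin d, HasCompactSupport fun y : Euc d => fderiv ℝ radialBump y (stdVec j) :=
      fun j => hasCompactSupport_radialBump.fderiv_apply ℝ _
    rw [laplacian_eq_sum hH2.contDiffAt]
    have h2 : ∀ j : Fin d, (fun y => fderiv ℝ H y (stdVec j)) =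
        convolution (fun y => fderiv ℝ radialBump y (stdVec j))
            u (ContinuousLinearMap.mul ℝ ℝ) volume :=
      fun j => funext fun y => fderiv_convolution_apply (hb2.of_le one_le_two)
        hasCompactSupport_radialBump hu y _
    simp only [h2, fderiv_convolution_apply (hd1 _) (hcs _) hu, convolution_eq_swap]
    rw [← integral_finsetSum, ← h0]
    · refine integral_congr_ae (ae_of_all _ fun z => ?_)
      simp only [laplacian_eq_sum hb2.contDiffAt, Finset.sum_mul]
      rfl
    · intro j _
      have hcont : Continuous fun y : Euc d =>
          fderiv ℝ (fun y : Euc d => fderiv ℝ radialBump y (stdVec j)) y (stdVec j) :=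
        ((hd1 j).continuous_fderiv one_ne_zero).clm_apply continuous_const
      have := hu.integrable_smul_left_of_hasCompactSupport
        (hcont.comp (continuous_const.sub continuous_id : Continuous fun z => x - z))
        (((hcs j).fderiv_apply ℝ (stdVec j)).comp_homeomorph (Homeomorph.subLeft x))
      simpa using this
  refine ⟨c⁻¹ • H, fun x _ => ⟨(contDiff_const.smul hH2).contDiffAt, ?_⟩, ?_⟩
  · refine Eventually.of_forall fun y => ?_
    rw [InnerProductSpace.laplacian_smul _ hH2.contDiffAt, hHlap]
    simp
  · filter_upwards [ae_tendsto_integral_scaled_radialBump hu] with x hx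
    refine tendsto_nhds_unique hx (tendsto_const_nhds.congr' ?_)
    filter_upwards [eventually_gt_atTop (0 : ℝ)] with s hs
    simp only [smul_eq_mul, mul_assoc, Pi.smul_apply]
    rw [integral_const_mul, hHval, ← integral_scaled_radialBump_eq hu h x hs]
    simp only [mul_assoc, hc]

end Weyl

/-! ### Integrals against test functions -/

section Limits

variable {X : Type*} [TopologicalSpace X] [MeasurableSpace X] [OpensMeasurableSpace X] [T2Space X]
  {μ : Measure X} {w : ℕ → X → ℝ} {u g : X → ℝ} {K : Set X}

/-- Convergence in `L¹(K)` may be tested against a continuous function that vanishes off `K`. -/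
theorem tendsto_integral_mul_of_tendsto_lintegral (hK : IsCompact K) (hg : Continuous g)
    (hgK : ∀ x ∉ K, g x = 0) (hw : ∀ n, Integrable (fun x => w n x * g x) μ)
    (hu : Integrable (fun x => u x * g x) μ)
    (h : Tendsto (fun n => ∫⁻ x in K, ‖w n x - u x‖ₑ ∂μ) atTop (𝓝 0)) :
    Tendsto (fun n => ∫ x, w n x * g x ∂μ) atTop (𝓝 (∫ x, u x * g x ∂μ)) := by
  obtain ⟨C, hC⟩ := (hK.image hg).isBounded.exists_norm_le
  refine tendsto_integral_of_L1 _ hu.aestronglyMeasurable (Eventually.of_forall hw) ?_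
  have hlim : Tendsto (fun n => ENNReal.ofReal C * ∫⁻ x in K, ‖w n x - u x‖ₑ ∂μ) atTop (𝓝 0) := by
    simpa using ENNReal.Tendsto.const_mul h (Or.inr ENNReal.ofReal_ne_top)
  refine tendsto_of_tendsto_of_tendsto_of_le_of_le tendsto_const_nhds hlim
      (fun _ => zero_le) fun n => ?_
  rw [← lintegral_const_mul' _ _ ENNReal.ofReal_ne_top,
    ← lintegral_indicator hK.measurableSet]
  refine lintegral_mono fun x => ?_
  by_cases hx : x ∈ K
  · rw [indicator_of_mem hx, ← sub_mul, enorm_mul, mul_comm]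
    gcongr
    rw [← ofReal_norm]
    exact ENNReal.ofReal_le_ofReal (hC _ ⟨x, hx, rfl⟩)
  · simp [hgK x hx]

theorem integrableOn_of_tendsto_lintegral [IsFiniteMeasureOnCompacts μ] (hK : IsCompact K)
    (hw : ∀ n, Continuous (w n)) (hu : AEStronglyMeasurable u μ)
    (h : Tendsto (fun n => ∫⁻ x in K, ‖w n x - u x‖ₑ ∂μ) atTop (𝓝 0)) :
    IntegrableOn u K μ := by
  obtain ⟨n, hn⟩ := (h.eventually_lt_const ENNReal.zero_lt_top).exists
  have hwn : IntegrableOn (w n) K μ := (hw n).continuousOn.integrableOn_compact hK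
  have hd : IntegrableOn (fun x => w n x - u x) K μ :=
    ⟨hwn.aestronglyMeasurable.sub hu.restrict, hn⟩
  convert hwn.sub hd using 1
  ext x
  simp

theorem integrable_mul_of_integrableOn (hK : IsCompact K) (hg : Continuous g)
    (hgK : ∀ x ∉ K, g x = 0) (hu : IntegrableOn u K μ) : Integrable (fun x => u x * g x) μ := by
  have h : IntegrableOn (fun x => u x * g x) K μ := hu.mul_continuousOn hg.continuousOn hK
  refine (integrableOn_iff_integrable_of_support_subset fun x hx => ?_).1 h
  by_contra hcon
  exact hx (by simp [hgK x hcon])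

end Limits

/-! ### Uniqueness of weak derivatives -/

theorem ae_eq_of_distOfFun_eq {d : ℕ} {Ω : Opens (Euc d)} {f g : Euc d → ℝ}
    (hf : LocallyIntegrableOn f Ω) (hg : LocallyIntegrableOn g Ω)
    (h : distOfFun Ω f = distOfFun Ω g) : f =ᵐ[volume.restrict Ω] g := by
  have hfg : LocallyIntegrableOn (fun x => f x - g x) Ω := hf.sub hg
  have := Ω.isOpen.ae_eq_zero_of_integral_contDiff_smul_eq_zero hfg fun χ h1 h2 h3 => ?_
  · rw [EventuallyEq, ae_restrict_iff' Ω.isOpen.measurableSet]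
    filter_upwards [this] with x hx hxΩ
    exact sub_eq_zero.1 (hx hxΩ)
  · let ψ : 𝓓(Ω, ℝ) := ⟨χ, h1, h2, h3⟩
    have e := congrArg (fun T : 𝓓'(Ω, ℝ) => T ψ) h
    simp only [distOfFun_apply hf, distOfFun_apply hg] at e
    have i1 := TestFunction.integrable_bilin (ContinuousLinearMap.mul ℝ ℝ) hf ψ
    have i2 := TestFunction.integrable_bilin (ContinuousLinearMap.mul ℝ ℝ) hg ψ
    have := integral_sub i1 i2
    simp only [ContinuousLinearMap.mul_apply'] at this
    rw [e, sub_self] at this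
    rw [← this]
    refine integral_congr_ae (ae_of_all _ fun x => ?_)
    simp only [smul_eq_mul, mul_sub]
    rfl

theorem HasWeakGradient.ae_eq {d : ℕ} {Ω : Opens (Euc d)} {u : Euc d → ℝ} {G G' : Euc d → Euc d}
    (h : HasWeakGradient Ω u G) (h' : HasWeakGradient Ω u G') (j : Fin d) :
    (fun x => G x j) =ᵐ[volume.restrict Ω] fun x => G' x j :=
  ae_eq_of_distOfFun_eq (h.2 j).2.1 (h'.2 j).2.1 ((h.2 j).2.2.symm.trans (h'.2 j).2.2)

/-- The weak divergence of the weak gradient of a harmonic function vanishes. -/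
theorem HasWeakDivergence.ae_eq_zero {d : ℕ} {Ω : Opens (Euc d)} {u D : Euc d → ℝ}
    {G : Euc d → Euc d} (hG : HasWeakGradient Ω u G) (hD : HasWeakDivergence Ω G D)
    (hΔ : distLaplacian (distOfFun Ω u) = 0) : D =ᵐ[volume.restrict Ω] 0 := by
  have h0 : LocallyIntegrableOn (0 : Euc d → ℝ) Ω := locallyIntegrableOn_zero
  refine ae_eq_of_distOfFun_eq hD.2.1 h0 ?_
  rw [← hD.2.2]
  have h1 : ∑ j : Fin d, ∂_{stdVec j} (distOfFun Ω (fun x => G x j)) =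
      distLaplacian (distOfFun Ω u) :=
    Finset.sum_congr rfl fun j _ => by rw [← (hG.2 j).2.2]
  rw [h1, hΔ]
  ext ψ
  rw [distOfFun_apply h0]
  simp

/-! ### Green's identity for functions with traces -/

theorem sum_fderiv_mul_inner_stdVec {d : ℕ} (L : Euc d →L[ℝ] ℝ) (v : Euc d) :
    ∑ j, L (stdVec j) * inner ℝ v (stdVec j) = L v := by
  have hv : v = ∑ j, v j • stdVec j := by
    have := (EuclideanSpace.basisFun (Fin d) ℝ).sum_repr v
    simpa [stdVec] using this.symm
  conv_rhs => rw [hv]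
  simp [stdVec, EuclideanSpace.inner_single_right, mul_comm]

section Green

variable {d : ℕ} {Ω : Opens (Euc d)} {S : Set (Euc d)} {ν : Euc d → Euc d} {ε : ℝ}
  {u g h : Euc d → ℝ}

theorem tendsto_lintegral_component {μ : Measure (Euc d)} {F : ℕ → Euc d → Euc d}
    {G : Euc d → Euc d} (h : Tendsto (fun n => ∫⁻ x, ‖F n x - G x‖ₑ ∂μ) atTop (𝓝 0)) (j : Fin d) :
    Tendsto (fun n => ∫⁻ x, ‖F n x j - G x j‖ₑ ∂μ) atTop (𝓝 0) := by
  refine tendsto_of_tendsto_of_tendsto_of_le_of_le tendsto_const_nhds h (fun _ => zero_le)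
    fun n => lintegral_mono fun x => ?_
  have := PiLp.norm_apply_le (F n x - G x) j
  simp only [← ofReal_norm]
  exact ENNReal.ofReal_le_ofReal this

theorem lintegral_inter_eq {f : Euc d → ℝ≥0∞} {K : Set (Euc d)} (hK : IsCompact K) :
    ∫⁻ x in (Ω : Set (Euc d)) ∩ K, f x = ∫⁻ x in K, f x ∂(volume.restrict Ω) := by
  rw [Measure.restrict_restrict hK.measurableSet, inter_comm]

theorem gradient_apply_eq {f : Euc d → ℝ} (x : Euc d) (j : Fin d) :
    (∇ f x) j = fderiv ℝ f x (stdVec j) := by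
  have h : inner ℝ (∇ f x) (stdVec j) = (∇ f x) j := by
    rw [stdVec, EuclideanSpace.inner_single_right]
    simp
  rw [← h, inner_gradient_left]

/-- A function with a trace is integrable up to the boundary, and not just locally inside `Ω`. -/
theorem HasTrace.integrableOn (ht : HasTrace Ω S u g) {K : Set (Euc d)} (hK : IsCompact K) :
    IntegrableOn u K (volume.restrict Ω) := by
  obtain ⟨-, G, hG, w, hw, hlim⟩ := ht
  have h1 := (hlim K hK).1
  simp only [lintegral_inter_eq hK] at h1
  exact integrableOn_of_tendsto_lintegral hK (fun n => (hw n).continuous)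
    (hG.1.aestronglyMeasurable) h1

/-- Integration by parts for a function with a trace, by passing to the limit in the divergence
theorem for the approximating functions. The sign `ε` is `1` if `ν` is the outer normal of `Ω` and
`-1` if it is the inner normal. -/
theorem HasTrace.integral_mul_fderiv [IsLocallyFiniteMeasure (surfaceMeasure S)]
    (hνm : AEStronglyMeasurable ν (surfaceMeasure S))
    (hν : ∀ᵐ x ∂surfaceMeasure S, ‖ν x‖ = 1)
    (hdiv : ∀ ψ : Euc d → ℝ, ContDiff ℝ 1 ψ → HasCompactSupport ψ → ∀ v,
      ∫ x in Ω, fderiv ℝ ψ x v = ε * ∫ x, ψ x * inner ℝ (ν x) v ∂surfaceMeasure S)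
    (ht : HasTrace Ω S u g) :
    ∃ G : Euc d → Euc d, HasWeakGradient Ω u G ∧ ∀ χ : Euc d → ℝ, ContDiff ℝ 1 χ →
      HasCompactSupport χ → ∀ j : Fin d,
        Integrable (fun x => G x j * χ x) (volume.restrict Ω) ∧
        (∫ x in Ω, u x * fderiv ℝ χ x (stdVec j)) + ∫ x in Ω, G x j * χ x =
          ε * ∫ x, g x * (χ x * inner ℝ (ν x) (stdVec j)) ∂surfaceMeasure S := by
  have huK := fun K hK => ht.integrableOn (K := K) hK
  obtain ⟨hg, G, hG, w, hw, hlim⟩ := ht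
  refine ⟨G, hG, fun χ hχ hc j => ?_⟩
  set K := tsupport χ with hKdef
  have hK : IsCompact K := hc.isCompact
  obtain ⟨h1, h2, h3⟩ := hlim K hK
  rw [funext fun n => lintegral_inter_eq hK] at h1 h2
  have h2' := tendsto_lintegral_component h2 j
  simp only [gradient_apply_eq] at h2'
  have hχ0 : ∀ x ∉ K, χ x = 0 := fun x hx => image_eq_zero_of_notMem_tsupport hx
  have hdχ0 : ∀ x ∉ K, fderiv ℝ χ x (stdVec j) = 0 := fun x hx => by
    rw [image_eq_zero_of_notMem_tsupport (f := fderiv ℝ χ) fun h => hx (tsupport_fderiv_subset ℝ h)]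
    simp
  have hdχc : Continuous fun x => fderiv ℝ χ x (stdVec j) :=
    (hχ.continuous_fderiv one_ne_zero).clm_apply continuous_const
  have hdw : ∀ n, Continuous fun x => fderiv ℝ (w n) x (stdVec j) := fun n =>
    ((hw n).continuous_fderiv (by simp)).clm_apply continuous_const
  have hGK : IntegrableOn (fun x => G x j) K (volume.restrict Ω) :=
    integrableOn_of_tendsto_lintegral hK hdw
      ((hG.2 j).2.1.aestronglyMeasurable) h2'
  have hcomp : ∀ {μ : Measure (Euc d)} [IsFiniteMeasureOnCompacts μ] {f k : Euc d → ℝ},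
      Continuous f → Continuous k → (∀ x ∉ K, k x = 0) → Integrable (fun x => f x * k x) μ :=
    fun hf hk hk0 => integrable_mul_of_integrableOn hK hk hk0
        (hf.continuousOn.integrableOn_compact hK)
  have iG := integrable_mul_of_integrableOn hK hχ.continuous hχ0 hGK
  refine ⟨iG, ?_⟩
  have l1 := tendsto_integral_mul_of_tendsto_lintegral (μ := volume.restrict Ω) hK hdχc hdχ0
    (fun n => hcomp (hw n).continuous hdχc hdχ0)
    (integrable_mul_of_integrableOn hK hdχc hdχ0 (huK K hK)) h1
  have l2 := tendsto_integral_mul_of_tendsto_lintegral (μ := volume.restrict Ω) hK hχ.continuous hχ0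
    (fun n => hcomp (hdw n) hχ.continuous hχ0) iG h2'
  have hbd : ∀ᵐ x ∂surfaceMeasure S, ‖inner ℝ (ν x) (stdVec j)‖ ≤ 1 := by
    filter_upwards [hν] with x hx
    have := norm_inner_le_norm (𝕜 := ℝ) (ν x) (stdVec j)
    simpa [hx, stdVec] using this
  have hinm : AEStronglyMeasurable (fun x => inner ℝ (ν x) (stdVec j)) (surfaceMeasure S) :=
    hνm.inner aestronglyMeasurable_const
  have l3 : Tendsto (fun n => ∫ x, w n x * (χ x * inner ℝ (ν x) (stdVec j)) ∂surfaceMeasure S) atTop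
      (𝓝 (∫ x, g x * (χ x * inner ℝ (ν x) (stdVec j)) ∂surfaceMeasure S)) := by
    have hlim3 : Tendsto (fun n => ∫⁻ x in K, ‖w n x * inner ℝ (ν x) (stdVec j) -
        g x * inner ℝ (ν x) (stdVec j)‖ₑ ∂surfaceMeasure S) atTop (𝓝 0) := by
      refine tendsto_of_tendsto_of_tendsto_of_le_of_le tendsto_const_nhds h3 (fun _ => zero_le)
        fun n => lintegral_mono_ae ?_
      filter_upwards [ae_restrict_of_ae hbd] with x hx
      rw [← sub_mul, enorm_mul]
      refine mul_le_of_le_one_right zero_le ?_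
      rw [← ofReal_norm]
      exact ENNReal.ofReal_le_one.2 hx
    have := tendsto_integral_mul_of_tendsto_lintegral (μ := surfaceMeasure S)
      (w := fun n x => w n x * inner ℝ (ν x) (stdVec j))
      (u := fun x => g x * inner ℝ (ν x) (stdVec j)) hK hχ.continuous hχ0
      (fun n => ?_) ?_ hlim3
    · simpa only [mul_assoc, mul_comm (inner ℝ _ _) (χ _)] using this
    · have := (hcomp (μ := surfaceMeasure S) (hw n).continuous hχ.continuous hχ0).mul_bdd hinm hbd
      simpa only [mul_right_comm] using this
    · have := (integrable_mul_of_integrableOn hK hχ.continuous hχ0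
        (hg.integrableOn_isCompact hK)).mul_bdd hinm hbd
      simpa only [mul_right_comm] using this
  have hn : ∀ n, (∫ x in Ω, w n x * fderiv ℝ χ x (stdVec j)) +
      ∫ x in Ω, fderiv ℝ (w n) x (stdVec j) * χ x =
      ε * ∫ x, w n x * (χ x * inner ℝ (ν x) (stdVec j)) ∂surfaceMeasure S := by
    intro n
    have e := hdiv (fun x => w n x * χ x) (((hw n).of_le (by simp)).mul hχ) hc.mul_left (stdVec j)
    simp only [mul_assoc] at e
    rw [← e, ← integral_add (hcomp (hw n).continuous hdχc hdχ0) (hcomp (hdw n) hχ.continuous hχ0)]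
    refine integral_congr_ae (ae_of_all _ fun x => ?_)
    simp only []
    rw [fderiv_fun_mul ((hw n).differentiable (by simp) x) (hχ.differentiable one_ne_zero x)]
    simp [mul_comm]
  exact tendsto_nhds_unique (l1.add l2) ((l3.const_mul ε).congr fun n => (hn n).symm)

/-- Integration by parts for the gradient of a harmonic function with a normal trace, by passing to
the limit in the divergence theorem for the approximating fields. The divergence term vanishes in
the limit, because the weak divergence of the gradient is the Laplacian. -/
theorem HasNormalTrace.integral_mul_fderiv [IsLocallyFiniteMeasure (surfaceMeasure S)]
    (hνm : AEStronglyMeasurable ν (surfaceMeasure S))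
    (hν : ∀ᵐ x ∂surfaceMeasure S, ‖ν x‖ = 1)
    (hdiv : ∀ ψ : Euc d → ℝ, ContDiff ℝ 1 ψ → HasCompactSupport ψ → ∀ v,
      ∫ x in Ω, fderiv ℝ ψ x v = ε * ∫ x, ψ x * inner ℝ (ν x) v ∂surfaceMeasure S)
    (ht : HasNormalTrace Ω S ν u h) (hΔ : distLaplacian (distOfFun Ω u) = 0) :
    ∃ G : Euc d → Euc d, HasWeakGradient Ω u G ∧ ∀ χ : Euc d → ℝ, ContDiff ℝ 1 χ →
      HasCompactSupport χ →
        ∑ j, ∫ x in Ω, G x j * fderiv ℝ χ x (stdVec j) =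
          ε * ∫ x, h x * χ x ∂surfaceMeasure S := by
  obtain ⟨hh, G, D, hG, hD, F, hF, hlim⟩ := ht
  refine ⟨G, hG, fun χ hχ hc => ?_⟩
  have hD0 := hD.ae_eq_zero hG hΔ
  set K := tsupport χ with hKdef
  have hK : IsCompact K := hc.isCompact
  obtain ⟨h1, h2, h3⟩ := hlim K hK
  rw [funext fun n => lintegral_inter_eq hK] at h1 h2
  have h1' := tendsto_lintegral_component h1
  have hχ0 : ∀ x ∉ K, χ x = 0 := fun x hx => image_eq_zero_of_notMem_tsupport hx
  have hdχ0 : ∀ j : Fin d, ∀ x ∉ K, fderiv ℝ χ x (stdVec j) = 0 := fun j x hx => by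
    rw [image_eq_zero_of_notMem_tsupport (f := fderiv ℝ χ) fun h => hx (tsupport_fderiv_subset ℝ h)]
    simp
  have hdχc : ∀ j : Fin d, Continuous fun x => fderiv ℝ χ x (stdVec j) := fun j =>
    (hχ.continuous_fderiv one_ne_zero).clm_apply continuous_const
  have hFj : ∀ n j, ContDiff ℝ ∞ fun x => F n x j := fun n j => by
    have := hF n
    fun_prop
  have hdF : ∀ n (j : Fin d), Continuous fun x => fderiv ℝ
      (fun y => F n y j) x (stdVec j) := fun n j =>
    ((hFj n j).continuous_fderiv (by simp)).clm_apply continuous_const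
  have hdivF : ∀ n x, divergence (F n) x = ∑ j, fderiv ℝ (fun y => F n y j) x (stdVec j) := by
    intro n x
    refine Finset.sum_congr rfl fun j _ => ?_
    have := ((EuclideanSpace.proj (𝕜 := ℝ) j).hasFDerivAt).comp x
      ((hF n).differentiable (by simp) x).hasFDerivAt
    change _ = fderiv ℝ ((EuclideanSpace.proj (𝕜 := ℝ) j) ∘ F n) x (stdVec j)
    rw [this.fderiv]
    rfl
  have hdivc : ∀ n, Continuous (divergence (F n)) := fun n => by
    rw [funext (hdivF n)]
    exact continuous_finsetSum _ fun j _ => hdF n j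
  have hGK : ∀ j, IntegrableOn (fun x => G x j) K (volume.restrict Ω) := fun j =>
    integrableOn_of_tendsto_lintegral hK (fun n => (hFj n j).continuous)
      ((hG.2 j).2.1.aestronglyMeasurable) (h1' j)
  have hcomp : ∀ {μ : Measure (Euc d)} [IsFiniteMeasureOnCompacts μ] {f k : Euc d → ℝ},
      Continuous f → Continuous k → (∀ x ∉ K, k x = 0) → Integrable (fun x => f x * k x) μ :=
    fun hf hk hk0 => integrable_mul_of_integrableOn hK hk hk0
        (hf.continuousOn.integrableOn_compact hK)
  have hDχ : (fun x => D x * χ x) =ᵐ[volume.restrict Ω] 0 := by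
    filter_upwards [hD0] with x hx
    simp [hx]
  have l1 : Tendsto (fun n => ∑ j, ∫ x in Ω, F n x j * fderiv ℝ χ x (stdVec j)) atTop
      (𝓝 (∑ j, ∫ x in Ω, G x j * fderiv ℝ χ x (stdVec j))) :=
    tendsto_finsetSum _ fun j _ =>
      tendsto_integral_mul_of_tendsto_lintegral hK (hdχc j) (hdχ0 j)
        (fun n => hcomp (hFj n j).continuous (hdχc j) (hdχ0 j))
        (integrable_mul_of_integrableOn hK (hdχc j) (hdχ0 j) (hGK j)) (h1' j)
  have l2 : Tendsto (fun n => ∫ x in Ω, divergence (F n) x * χ x) atTop (𝓝 0) := by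
    have := tendsto_integral_mul_of_tendsto_lintegral (μ := volume.restrict Ω) hK hχ.continuous hχ0
      (fun n => hcomp (hdivc n) hχ.continuous hχ0) ((integrable_zero _ _ _).congr hDχ.symm) h2
    rwa [integral_eq_zero_of_ae hDχ] at this
  have hinn : ∀ n x, inner ℝ (F n x) (ν x) = ∑ j, F n x j * inner ℝ (ν x) (stdVec j) := by
    intro n x
    simp [PiLp.inner_apply, stdVec, mul_comm]
  have hbd : ∀ j : Fin d, ∀ᵐ x ∂surfaceMeasure S, ‖inner ℝ (ν x) (stdVec j)‖ ≤ 1 := by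
    intro j
    filter_upwards [hν] with x hx
    have := norm_inner_le_norm (𝕜 := ℝ) (ν x) (stdVec j)
    simpa [hx, stdVec] using this
  have hinm : ∀ j : Fin d, AEStronglyMeasurable (fun x => inner ℝ (ν x) (stdVec j))
      (surfaceMeasure S) := fun j => hνm.inner aestronglyMeasurable_const
  have hsj : ∀ n j, Integrable (fun x => F n x j * χ x * inner ℝ (ν x) (stdVec j))
      (surfaceMeasure S) := fun n j =>
    (hcomp (μ := surfaceMeasure S) (hFj n j).continuous hχ.continuous hχ0).mul_bdd (hinm j) (hbd j)
  have hFν : ∀ n, (fun x => inner ℝ (F n x) (ν x) * χ x) =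
      fun x => ∑ j, F n x j * χ x * inner ℝ (ν x) (stdVec j) := fun n => by
    ext x
    rw [hinn, Finset.sum_mul]
    exact Finset.sum_congr rfl fun j _ => by ring
  have l3 := tendsto_integral_mul_of_tendsto_lintegral (μ := surfaceMeasure S) hK hχ.continuous hχ0
    (w := fun n x => inner ℝ (F n x) (ν x))
    (fun n => by rw [hFν]; exact integrable_finsetSum _ fun j _ => hsj n j)
    (integrable_mul_of_integrableOn hK hχ.continuous hχ0 (hh.integrableOn_isCompact hK)) h3
  have hn : ∀ n, (∑ j, ∫ x in Ω, F n x j * fderiv ℝ χ x (stdVec j)) +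
      ∫ x in Ω, divergence (F n) x * χ x =
      ε * ∫ x, inner ℝ (F n x) (ν x) * χ x ∂surfaceMeasure S := by
    intro n
    rw [hFν, integral_finsetSum _ fun j _ => hsj n j, Finset.mul_sum]
    simp only [hdivF, Finset.sum_mul]
    rw [integral_finsetSum _ fun j _ => hcomp (hdF n j) hχ.continuous hχ0, ← Finset.sum_add_distrib]
    refine Finset.sum_congr rfl fun j _ => ?_
    have e := hdiv (fun x => F n x j * χ x) (((hFj n j).of_le (by simp)).mul hχ)
        hc.mul_left (stdVec j)
    rw [← e, ← integral_add (hcomp (hFj n j).continuous (hdχc j) (hdχ0 j))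
      (hcomp (hdF n j) hχ.continuous hχ0)]
    refine integral_congr_ae (ae_of_all _ fun x => ?_)
    simp only []
    rw [fderiv_fun_mul ((hFj n j).differentiable (by simp) x) (hχ.differentiable one_ne_zero x)]
    simp [mul_comm]
  have := tendsto_nhds_unique (l1.add l2) ((l3.const_mul ε).congr fun n => (hn n).symm)
  rwa [add_zero] at this

/-- Green's second identity for a harmonic function with traces against a test function. The two
weak gradients that come with the two traces agree almost everywhere. -/
theorem integral_mul_laplacian_of_hasTrace [IsLocallyFiniteMeasure (surfaceMeasure S)]
    (hνm : AEStronglyMeasurable ν (surfaceMeasure S))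
    (hν : ∀ᵐ x ∂surfaceMeasure S, ‖ν x‖ = 1)
    (hdiv : ∀ ψ : Euc d → ℝ, ContDiff ℝ 1 ψ → HasCompactSupport ψ → ∀ v,
      ∫ x in Ω, fderiv ℝ ψ x v = ε * ∫ x, ψ x * inner ℝ (ν x) v ∂surfaceMeasure S)
    (hg : HasTrace Ω S u g) (hh : HasNormalTrace Ω S ν u h)
    (hΔ : distLaplacian (distOfFun Ω u) = 0) {ψ : Euc d → ℝ} (hψ : ContDiff ℝ 2 ψ)
    (hc : HasCompactSupport ψ) :
    ∫ x in Ω, Laplacian.laplacian ψ x * u x =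
      ε * ((∫ x, g x * inner ℝ (∇ ψ x) (ν x) ∂surfaceMeasure S) -
        ∫ x, h x * ψ x ∂surfaceMeasure S) := by
  obtain ⟨G, hG, hGreen⟩ := hg.integral_mul_fderiv hνm hν hdiv
  obtain ⟨G', hG', hGreen'⟩ := hh.integral_mul_fderiv hνm hν hdiv hΔ
  have hd1 : ∀ j : Fin d, ContDiff ℝ 1 fun y => fderiv ℝ ψ y (stdVec j) := fun j =>
    (hψ.fderiv_right (m := 1) (by norm_num)).clm_apply contDiff_const
  have hcs : ∀ j : Fin d, HasCompactSupport fun y => fderiv ℝ ψ y (stdVec j) :=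
    fun j => hc.fderiv_apply ℝ _
  have e1 : ∑ j, ∫ x in Ω, G x j * fderiv ℝ ψ x (stdVec j) =
      ε * ∫ x, h x * ψ x ∂surfaceMeasure S := by
    rw [← hGreen' ψ (hψ.of_le one_le_two) hc]
    refine Finset.sum_congr rfl fun j _ => integral_congr_ae ?_
    filter_upwards [hG.ae_eq hG' j] with x hx
    simp only [hx]
  have e2 : ∑ j, ((∫ x in Ω, u x * fderiv ℝ (fun y => fderiv ℝ ψ y (stdVec j)) x (stdVec j)) +
      ∫ x in Ω, G x j * fderiv ℝ ψ x (stdVec j)) =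
      ∑ j, ε * ∫ x, g x * (fderiv ℝ ψ x (stdVec j) * inner ℝ (ν x) (stdVec j)) ∂surfaceMeasure S :=
    Finset.sum_congr rfl fun j _ => (hGreen _ (hd1 j) (hcs j) j).2
  have hbd : ∀ j : Fin d, ∀ᵐ x ∂surfaceMeasure S, ‖inner ℝ (ν x) (stdVec j)‖ ≤ 1 := by
    intro j
    filter_upwards [hν] with x hx
    have := norm_inner_le_norm (𝕜 := ℝ) (ν x) (stdVec j)
    simpa [hx, stdVec] using this
  have i1 : ∀ j : Fin d, Integrable (fun x => u x *
      fderiv ℝ (fun y => fderiv ℝ ψ y (stdVec j)) x (stdVec j)) (volume.restrict Ω) := fun j =>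
    integrable_mul_of_integrableOn ((hcs j).fderiv_apply ℝ (stdVec j)).isCompact
      (((hd1 j).continuous_fderiv one_ne_zero).clm_apply continuous_const)
      (fun x hx => image_eq_zero_of_notMem_tsupport
        (f := fun x => fderiv ℝ (fun y => fderiv ℝ ψ y (stdVec j)) x (stdVec j)) hx)
      (hg.integrableOn ((hcs j).fderiv_apply ℝ (stdVec j)).isCompact)
  have i2 : ∀ j : Fin d, Integrable (fun x => g x * (fderiv ℝ ψ x (stdVec j) *
      inner ℝ (ν x) (stdVec j))) (surfaceMeasure S) := fun j => by
    have h1 := integrable_mul_of_integrableOn (hcs j).isCompact (hd1 j).continuous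
      (fun x hx => image_eq_zero_of_notMem_tsupport (f := fun y => fderiv ℝ ψ y (stdVec j)) hx)
      (hg.1.integrableOn_isCompact (hcs j).isCompact)
    have h2 := h1.mul_bdd (hνm.inner (aestronglyMeasurable_const (b := stdVec j))) (hbd j)
    simpa only [mul_assoc] using h2
  rw [Finset.sum_add_distrib, e1, ← Finset.mul_sum, ← integral_finsetSum _ fun j _ => i1 j,
    ← integral_finsetSum _ fun j _ => i2 j] at e2
  simp only [← Finset.mul_sum, sum_fderiv_mul_inner_stdVec, ← laplacian_eq_sum hψ.contDiffAt] at e2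
  simp only [inner_gradient_left, mul_comm (Laplacian.laplacian ψ _)]
  linarith

end Green

/-! ### Harmonic functions are weakly harmonic -/

theorem integral_mul_fderiv_of_hasCompactSupport {d : ℕ} {f g : Euc d → ℝ} (hf : ContDiff ℝ 1 f)
    (hg : ContDiff ℝ 1 g) (hc : HasCompactSupport g) (v : Euc d) :
    ∫ x, f x * fderiv ℝ g x v = -∫ x, fderiv ℝ f x v * g x := by
  have hdf : Continuous fun x => fderiv ℝ f x v :=
    (hf.continuous_fderiv one_ne_zero).clm_apply continuous_const
  have hdg : Continuous fun x => fderiv ℝ g x v :=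
    (hg.continuous_fderiv one_ne_zero).clm_apply continuous_const
  exact integral_mul_fderiv_eq_neg_fderiv_mul_of_integrable
    ((hdf.mul hg.continuous).integrable_of_hasCompactSupport hc.mul_left)
    ((hf.continuous.mul hdg).integrable_of_hasCompactSupport (hc.fderiv_apply ℝ v).mul_left)
    ((hf.continuous.mul hg.continuous).integrable_of_hasCompactSupport hc.mul_left)
    (fun x _ => hf.differentiable one_ne_zero x) (fun x _ => hg.differentiable one_ne_zero x)

theorem integral_laplacian_mul_eq_zero_of_harmonic {d : ℕ} {H ψ : Euc d → ℝ}
    (hH : InnerProductSpace.HarmonicOnNhd H univ) (hψ : ContDiff ℝ 2 ψ)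
    (hc : HasCompactSupport ψ) : ∫ x, Laplacian.laplacian ψ x * H x = 0 := by
  have hH2 : ContDiff ℝ 2 H := contDiff_iff_contDiffAt.2 fun x => (hH x (mem_univ x)).1
  have hΔ : ∀ x, Laplacian.laplacian H x = 0 := fun x => (hH x (mem_univ x)).2.self_of_nhds
  have d1 : ∀ {f : Euc d → ℝ}, ContDiff ℝ 2 f → ∀ j : Fin d,
      ContDiff ℝ 1 fun y => fderiv ℝ f y (stdVec j) := fun hf j =>
    (hf.fderiv_right (m := 1) (by norm_num)).clm_apply contDiff_const
  have d2 : ∀ {f : Euc d → ℝ}, ContDiff ℝ 2 f → ∀ j : Fin d,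
      Continuous fun x => fderiv ℝ (fun y => fderiv ℝ f y (stdVec j)) x (stdVec j) := fun hf j =>
    ((d1 hf j).continuous_fderiv one_ne_zero).clm_apply continuous_const
  have hparts : ∀ j : Fin d,
      ∫ x, H x * fderiv ℝ (fun y => fderiv ℝ ψ y (stdVec j)) x (stdVec j) =
        ∫ x, fderiv ℝ (fun y => fderiv ℝ H y (stdVec j)) x (stdVec j) * ψ x := fun j => by
    rw [integral_mul_fderiv_of_hasCompactSupport (hH2.of_le one_le_two) (d1 hψ j)
      (hc.fderiv_apply ℝ _), integral_mul_fderiv_of_hasCompactSupport (d1 hH2 j)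
      (hψ.of_le one_le_two) hc, neg_neg]
  have i1 : ∀ j : Fin d, Integrable fun x =>
      H x * fderiv ℝ (fun y => fderiv ℝ ψ y (stdVec j)) x (stdVec j) := fun j =>
    (hH2.continuous.mul (d2 hψ j)).integrable_of_hasCompactSupport
      ((hc.fderiv_apply ℝ (stdVec j)).fderiv_apply ℝ (stdVec j)).mul_left
  have i2 : ∀ j : Fin d, Integrable fun x =>
      fderiv ℝ (fun y => fderiv ℝ H y (stdVec j)) x (stdVec j) * ψ x := fun j =>
    ((d2 hH2 j).mul hψ.continuous).integrable_of_hasCompactSupport hc.mul_left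
  simp only [laplacian_eq_sum hψ.contDiffAt, mul_comm _ (H _), Finset.mul_sum]
  rw [integral_finsetSum _ fun j _ => i1 j, Finset.sum_congr rfl fun j _ => hparts j,
    ← integral_finsetSum _ fun j _ => i2 j]
  simp only [← Finset.sum_mul, ← laplacian_eq_sum hH2.contDiffAt, hΔ, zero_mul, integral_zero]

/-! ### Independence of the two layers -/

theorem IsInterface.ae_eq_zero_of_local {n : ℕ} {Ωi Ωo : Opens (Euc (n + 1))}
    {S : Set (Euc (n + 1))} {ν : Euc (n + 1) → Euc (n + 1)} (hS : IsInterface Ωi S Ωo ν)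
    {a : Euc (n + 1) → ℝ}
    (h : ∀ x ∈ S, ∃ U ∈ 𝓝 x, ∀ᵐ y ∂surfaceMeasure S, y ∈ U → a y = 0) :
    a =ᵐ[surfaceMeasure S] 0 := by
  have hnull : surfaceMeasure S {x | ¬ (x ∈ S → a x = 0)} = 0 := by
    refine measure_null_of_locally_null _ fun x hx => ?_
    obtain ⟨U, hU, h0⟩ := h x (by by_contra hcon; exact hx fun h => absurd h hcon)
    refine ⟨{x | ¬ (x ∈ S → a x = 0)} ∩ U, inter_mem_nhdsWithin _ hU, measure_mono_null ?_ h0⟩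
    rintro y ⟨hy, hyU⟩ hcon
    exact hy fun _ => hcon hyU
  have hmem : ∀ᵐ x ∂surfaceMeasure S, x ∈ S := ae_restrict_mem hS.isClosed.measurableSet
  filter_upwards [hmem, show ∀ᵐ x ∂surfaceMeasure S, x ∈ S → a x = 0 from hnull] with x h1 h2
  exact h2 h1

/-- The normal component of a continuous field, times a locally integrable density, is locally
integrable. -/
theorem IsInterface.locallyIntegrable_mul_inner {n : ℕ} {Ωi Ωo : Opens (Euc (n + 1))}
    {S : Set (Euc (n + 1))} {ν : Euc (n + 1) → Euc (n + 1)} (hS : IsInterface Ωi S Ωo ν)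
    {a : Euc (n + 1) → ℝ} {X : Euc (n + 1) → Euc (n + 1)}
    (ha : LocallyIntegrable a (surfaceMeasure S)) (hX : Continuous X) :
    LocallyIntegrable (fun x => a x * inner ℝ (X x) (ν x)) (surfaceMeasure S) := by
  rw [locallyIntegrable_iff]
  intro K hK
  obtain ⟨C, hC⟩ := (hK.image hX).isBounded.exists_norm_le
  refine Integrable.mul_bdd (c := C) (ha.integrableOn_isCompact hK)
    (hX.aestronglyMeasurable.inner hS.aestronglyMeasurable_normal.restrict) ?_
  filter_upwards [ae_restrict_mem hK.measurableSet, ae_restrict_of_ae hS.ae_norm_normal]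
    with x hx hνx
  have := norm_inner_le_norm (𝕜 := ℝ) (X x) (ν x)
  rw [hνx, mul_one] at this
  exact this.trans (hC _ ⟨x, hx, rfl⟩)

/-- A double layer is not a single layer unless it vanishes: at `x₀` the test functions `ρ χ`, with
`ρ` a defining function of `S`, vanish on `S`, while their normal derivative there is
`χ ⟪∇ρ, ν⟫`, which is an arbitrary test function up to a positive factor. -/
theorem IsInterface.exists_ae_eq_zero_of_doubleLayer {n : ℕ} {Ωi Ωo : Opens (Euc (n + 1))}
    {S : Set (Euc (n + 1))} {ν : Euc (n + 1) → Euc (n + 1)} (hS : IsInterface Ωi S Ωo ν)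
    {a b : Euc (n + 1) → ℝ} (ha : LocallyIntegrable a (surfaceMeasure S))
    (h : ∀ ψ : Euc (n + 1) → ℝ, ContDiff ℝ ∞ ψ → HasCompactSupport ψ →
      ∫ x, b x * ψ x ∂surfaceMeasure S = ∫ x, a x * inner ℝ (∇ ψ x) (ν x) ∂surfaceMeasure S)
    {x₀ : Euc (n + 1)} (hx₀ : x₀ ∈ S) :
    ∃ U ∈ 𝓝 x₀, ∀ᵐ y ∂surfaceMeasure S, y ∈ U → a y = 0 := by
  obtain ⟨ρ, hρ, hν⟩ := hS.normal x₀ hx₀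
  have hmem : ∀ᵐ x ∂surfaceMeasure S, x ∈ S := ae_restrict_mem hS.isClosed.measurableSet
  have hg : 0 < ‖∇ ρ x₀‖ := norm_pos_iff.2 hρ.gradient_ne_zero
  have hgc : Continuous (∇ ρ) :=
    (InnerProductSpace.toDual ℝ (Euc (n + 1))).symm.continuous.comp
      (hρ.contDiff.continuous_fderiv (by simp))
  have hpos0 : 0 < inner ℝ (∇ ρ x₀) (ν x₀) := by
    rw [hν, real_inner_smul_right, real_inner_self_eq_norm_sq]
    positivity
  have hpos : ∀ᶠ x in 𝓝[S] x₀, 0 < inner ℝ (∇ ρ x) (ν x) :=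
    (hgc.continuousWithinAt.inner (𝕜 := ℝ) (hS.normal_continuousOn x₀ hx₀)).eventually_const_lt
        hpos0
  obtain ⟨U, hU, hxU, hUS⟩ := mem_nhdsWithin.1 (hpos.and (hρ.mem_iff.filter_mono
      nhdsWithin_le_nhds))
  have hUρ : ∀ x ∈ U, x ∈ S → ρ x = 0 := fun x hx hxS => (hUS ⟨hx, hxS⟩).2.1 hxS
  refine ⟨U, hU.mem_nhds hxU, ?_⟩
  have hz := hU.ae_eq_zero_of_integral_contDiff_smul_eq_zero
    ((hS.locallyIntegrable_mul_inner ha hgc).locallyIntegrableOn U) fun χ h1 h2 h3 => ?_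
  · filter_upwards [hz, hmem] with x hx hxS hxU
    exact (mul_eq_zero.1 (hx hxU)).resolve_right (hUS ⟨hxU, hxS⟩).1.ne'
  · have hρχ : ∀ x ∈ S, ρ x * χ x = 0 := fun x hx => by
      by_cases hxU : x ∈ U
      · rw [hUρ x hxU hx, zero_mul]
      · rw [image_eq_zero_of_notMem_tsupport fun hc => hxU (h3 hc), mul_zero]
    have hρdχ : ∀ x ∈ S, ρ x • fderiv ℝ χ x = 0 := fun x hx => by
      by_cases hxU : x ∈ U
      · rw [hUρ x hxU hx, zero_smul]
      · rw [image_eq_zero_of_notMem_tsupport (f := fderiv ℝ χ) fun hc =>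
          hxU (h3 (tsupport_fderiv_subset ℝ hc)), smul_zero]
    have e := h (fun x => ρ x * χ x) (hρ.contDiff.mul h1) h2.mul_left
    rw [integral_eq_zero_of_ae (hmem.mono fun x hx => by simp [hρχ x hx])] at e
    rw [e]
    refine integral_congr_ae (hmem.mono fun x hx => ?_)
    simp only [inner_gradient_left, smul_eq_mul]
    rw [fderiv_fun_mul (hρ.contDiff.differentiable (by simp) x) (h1.differentiable (by simp) x),
      hρdχ x hx]
    simp only [zero_add, smul_apply, smul_eq_mul]
    ring

/-- If the single layer of density `b` and the double layer of density `a` cancel, both densities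
vanish. -/
theorem IsInterface.ae_eq_zero_of_layers {n : ℕ} {Ωi Ωo : Opens (Euc (n + 1))}
    {S : Set (Euc (n + 1))} {ν : Euc (n + 1) → Euc (n + 1)} (hS : IsInterface Ωi S Ωo ν)
    {a b : Euc (n + 1) → ℝ} (ha : LocallyIntegrable a (surfaceMeasure S))
    (hb : LocallyIntegrable b (surfaceMeasure S))
    (h : ∀ ψ : Euc (n + 1) → ℝ, ContDiff ℝ ∞ ψ → HasCompactSupport ψ →
      ∫ x, b x * ψ x ∂surfaceMeasure S = ∫ x, a x * inner ℝ (∇ ψ x) (ν x) ∂surfaceMeasure S) :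
    a =ᵐ[surfaceMeasure S] 0 ∧ b =ᵐ[surfaceMeasure S] 0 := by
  have ha0 := hS.ae_eq_zero_of_local fun x hx => hS.exists_ae_eq_zero_of_doubleLayer ha h hx
  refine ⟨ha0, ae_eq_zero_of_integral_contDiff_smul_eq_zero hb fun χ h1 h2 => ?_⟩
  have e := h χ h1 h2
  rw [integral_eq_zero_of_ae (f := fun x => a x * inner ℝ (∇ χ x) (ν x))
    (ha0.mono fun x hx => by simp [hx])] at e
  simpa only [smul_eq_mul, mul_comm] using e

/-! ### The jump formula -/

theorem glue_of_mem_left {d : ℕ} {Ωi Ωo : Opens (Euc d)} {φi φo : Euc d → ℝ} {x : Euc d}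
    (hx : x ∈ Ωi) : glue Ωi Ωo φi φo x = φi x := if_pos hx

theorem IsInterface.glue_of_mem_right {d : ℕ} {Ωi Ωo : Opens (Euc d)} {S : Set (Euc d)}
    {ν : Euc d → Euc d} (hS : IsInterface Ωi S Ωo ν) {φi φo : Euc d → ℝ} {x : Euc d}
    (hx : x ∈ Ωo) : glue Ωi Ωo φi φo x = φo x :=
  (if_neg fun hi => Set.disjoint_left.1 hS.disjoint_sides hi hx).trans (if_pos hx)

section Jump

variable {n : ℕ} {Ωi Ωo : Opens (Euc (n + 1))} {S : Set (Euc (n + 1))}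
  {ν : Euc (n + 1) → Euc (n + 1)} {φi φo γi γo ηi ηo : Euc (n + 1) → ℝ}

theorem IsInterface.locallyIntegrable_glue (hS : IsInterface Ωi S Ωo ν)
    (hγi : HasTrace Ωi S φi γi) (hγo : HasTrace Ωo S φo γo) :
    LocallyIntegrable (glue Ωi Ωo φi φo) := by
  rw [locallyIntegrable_iff]
  intro K hK
  have hi := hγi.integrableOn hK
  have ho := hγo.integrableOn hK
  rw [IntegrableOn, Measure.restrict_restrict hK.measurableSet] at hi ho
  have hi' : IntegrableOn (glue Ωi Ωo φi φo) (K ∩ Ωi) :=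
    IntegrableOn.congr_fun (f := φi) hi (fun x hx => (glue_of_mem_left hx.2).symm)
      (hK.measurableSet.inter Ωi.isOpen.measurableSet)
  have ho' : IntegrableOn (glue Ωi Ωo φi φo) (K ∩ Ωo) :=
    IntegrableOn.congr_fun (f := φo) ho (fun x hx => (hS.glue_of_mem_right hx.2).symm)
      (hK.measurableSet.inter Ωo.isOpen.measurableSet)
  have hs' : IntegrableOn (glue Ωi Ωo φi φo) S := by
    rw [IntegrableOn, Measure.restrict_eq_zero.2 hS.volume_eq_zero]
    exact integrable_zero_measure
  refine ((hi'.union ho').union hs').mono_set fun x hx => ?_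
  have := hS.cover.ge (mem_univ x)
  rcases this with (h | h) | h
  · exact Or.inl (Or.inl ⟨hx, h⟩)
  · exact Or.inr h
  · exact Or.inl (Or.inr ⟨hx, h⟩)

/-- The jump formula: Green's identities on the two sides, added. -/
theorem IsInterface.integral_laplacian_mul_glue (hS : IsInterface Ωi S Ωo ν)
    (hΔi : distLaplacian (distOfFun Ωi φi) = 0) (hΔo : distLaplacian (distOfFun Ωo φo) = 0)
    (hγi : HasTrace Ωi S φi γi) (hγo : HasTrace Ωo S φo γo)
    (hηi : HasNormalTrace Ωi S ν φi ηi) (hηo : HasNormalTrace Ωo S ν φo ηo)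
    {ψ : Euc (n + 1) → ℝ} (hψ : ContDiff ℝ 2 ψ) (hc : HasCompactSupport ψ) :
    ∫ x, Laplacian.laplacian ψ x * glue Ωi Ωo φi φo x =
      (∫ x, jump ηi ηo x * ψ x ∂surfaceMeasure S) -
        ∫ x, jump γi γo x * inner ℝ (∇ ψ x) (ν x) ∂surfaceMeasure S := by
  have hfin := hS.isLocallyFiniteMeasure
  have ei := integral_mul_laplacian_of_hasTrace (ε := 1) hS.aestronglyMeasurable_normal
    hS.ae_norm_normal (fun χ h1 h2 v => by rw [one_mul, hS.setIntegral_inside_fderiv h1 h2])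
    hγi hηi hΔi hψ hc
  have eo := integral_mul_laplacian_of_hasTrace (ε := -1) hS.aestronglyMeasurable_normal
    hS.ae_norm_normal (fun χ h1 h2 v => by rw [neg_one_mul, hS.setIntegral_outside_fderiv h1 h2])
    hγo hηo hΔo hψ hc
  have hint : Integrable fun x => Laplacian.laplacian ψ x * glue Ωi Ωo φi φo x :=
    (hS.locallyIntegrable_glue hγi hγo).integrable_smul_left_of_hasCompactSupport
      (continuous_laplacian hψ) (hasCompactSupport_laplacian hc)
  rw [← hS.setIntegral_add_setIntegral hint.integrableOn hint.integrableOn,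
    setIntegral_congr_fun (g := fun x => Laplacian.laplacian ψ x * φi x) Ωi.isOpen.measurableSet
      fun x hx => by simp only [glue_of_mem_left hx],
    setIntegral_congr_fun (g := fun x => Laplacian.laplacian ψ x * φo x) Ωo.isOpen.measurableSet
      fun x hx => by simp only [hS.glue_of_mem_right hx], ei, eo]
  have iη : ∀ {f : Euc (n + 1) → ℝ}, LocallyIntegrable f (surfaceMeasure S) →
      Integrable (fun x => f x * ψ x) (surfaceMeasure S) := fun hf =>
    integrable_mul_of_integrableOn hc.isCompact hψ.continuous
      (fun x hx => image_eq_zero_of_notMem_tsupport hx) (hf.integrableOn_isCompact hc.isCompact)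
  have hgc : Continuous (∇ ψ) := (InnerProductSpace.toDual ℝ (Euc (n + 1))).symm.continuous.comp
    (hψ.continuous_fderiv (by simp))
  have iγ : ∀ {f : Euc (n + 1) → ℝ}, LocallyIntegrable f (surfaceMeasure S) →
      Integrable (fun x => f x * inner ℝ (∇ ψ x) (ν x)) (surfaceMeasure S) := fun hf => by
    refine (integrableOn_iff_integrable_of_support_subset fun x hx => ?_).1
      ((hS.locallyIntegrable_mul_inner hf hgc).integrableOn_isCompact hc.isCompact)
    by_contra hcon
    refine hx ?_
    simp only [inner_gradient_left]
    rw [image_eq_zero_of_notMem_tsupport (f := fderiv ℝ ψ)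
      fun h => hcon (tsupport_fderiv_subset ℝ h)]
    simp
  simp only [jump, sub_mul]
  rw [integral_sub (iη hηo.1) (iη hηi.1), integral_sub (iγ hγo.1) (iγ hγi.1)]
  ring

end Jump

theorem distOfDensity_top_apply {d : ℕ} {μ : Measure (Euc d)} {u : Euc d → ℝ}
    (hu : LocallyIntegrable u μ) (ψ : 𝓓((⊤ : Opens (Euc d)), ℝ)) :
    distOfDensity ⊤ μ u ψ = ∫ x, ψ x * u x ∂μ :=
  distOfDensity_apply (hu.locallyIntegrableOn _) ψ

theorem IsInterface.doubleLayer_apply {n : ℕ} {Ωi Ωo : Opens (Euc (n + 1))}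
    {S : Set (Euc (n + 1))} {ν : Euc (n + 1) → Euc (n + 1)} (hS : IsInterface Ωi S Ωo ν)
    {f : Euc (n + 1) → ℝ} (hf : LocallyIntegrable f (surfaceMeasure S))
    (ψ : 𝓓((⊤ : Opens (Euc (n + 1))), ℝ)) :
    doubleLayer S ν f ψ =
      -∫ x, f x * inner ℝ (∇ (ψ : Euc (n + 1) → ℝ) x) (ν x) ∂surfaceMeasure S := by
  have hfin := hS.isLocallyFiniteMeasure
  have hνj : ∀ (x : Euc (n + 1)) (j), ν x j = inner ℝ (stdVec j) (ν x) := fun x j => by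
    rw [stdVec, EuclideanSpace.inner_single_left]
    simp
  have hfν : ∀ j, LocallyIntegrable (fun x => f x * ν x j) (surfaceMeasure S) := fun j => by
    simp only [hνj]
    exact hS.locallyIntegrable_mul_inner hf continuous_const
  have hterm : ∀ j, (∂_{stdVec j} (singleLayer S fun x => f x * ν x j)) ψ =
      -∫ x, fderiv ℝ (ψ : Euc (n + 1) → ℝ) x (stdVec j) * (f x * ν x j) ∂surfaceMeasure S :=
    fun j => by
      rw [lineDeriv_dist_apply, singleLayer, distOfDensity_top_apply (hfν j), coe_lineDerivOp]
  have hint : ∀ j, Integrable (fun x => fderiv ℝ (ψ : Euc (n + 1) → ℝ) x (stdVec j) *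
      (f x * ν x j)) (surfaceMeasure S) := fun j =>
    (hfν j).integrable_smul_left_of_hasCompactSupport
      ((ψ.contDiff.continuous_fderiv (by simp)).clm_apply continuous_const)
      (ψ.hasCompactSupport.fderiv_apply ℝ _)
  rw [doubleLayer, sum_apply, Finset.sum_congr rfl fun j _ => hterm j,
    Finset.sum_neg_distrib, ← integral_finsetSum _ fun j _ => hint j]
  congr 1
  refine integral_congr_ae (ae_of_all _ fun x => ?_)
  simp only [inner_gradient_left]
  rw [← sum_fderiv_mul_inner_stdVec, Finset.mul_sum]
  refine Finset.sum_congr rfl fun j _ => ?_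
  rw [hνj, real_inner_comm]
  ring

end Interface

theorem mainTheorem3 (d : ℕ) (hd : 1 ≤ d)
    (Ωi : TopologicalSpace.Opens (Interface.Euc d)) (S : Set (Interface.Euc d))
    (Ωo : TopologicalSpace.Opens (Interface.Euc d)) (ν : Interface.Euc d → Interface.Euc d)
    (hS : Interface.IsInterface Ωi S Ωo ν)
    (φi φo : Interface.Euc d → ℝ)
    (hφi : Interface.MemHloc Ωi 2 φi) (hφo : Interface.MemHloc Ωo 2 φo)
    (hΔi : Interface.distLaplacian (Interface.distOfFun Ωi φi) = 0)
    (hΔo : Interface.distLaplacian (Interface.distOfFun Ωo φo) = 0)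
    (γi γo ηi ηo : Interface.Euc d → ℝ)
    (hγi : Interface.HasTrace Ωi S φi γi) (hγo : Interface.HasTrace Ωo S φo γo)
    (hηi : Interface.HasNormalTrace Ωi S ν φi ηi)
    (hηo : Interface.HasNormalTrace Ωo S ν φo ηo) :
    MeasureTheory.LocallyIntegrable (Interface.glue Ωi Ωo φi φo) MeasureTheory.volume ∧
    (∀ ψ : 𝓓((⊤ : TopologicalSpace.Opens (Interface.Euc d)), ℝ),
      Interface.distLaplacian (Interface.distOfFun ⊤ (Interface.glue Ωi Ωo φi φo)) ψ =
        (∫ x, Interface.jump ηi ηo x * ψ x ∂(Interface.surfaceMeasure S)) -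
          ∫ x, Interface.jump γi γo x * inner ℝ (∇ (ψ : Interface.Euc d → ℝ) x) (ν x)
            ∂(Interface.surfaceMeasure S)) ∧
    Interface.distLaplacian (Interface.distOfFun ⊤ (Interface.glue Ωi Ωo φi φo)) =
      Interface.singleLayer S (Interface.jump ηi ηo) +
        Interface.doubleLayer S ν (Interface.jump γi γo) ∧
    (Interface.IsGloballyHarmonic (Interface.glue Ωi Ωo φi φo) ↔
      Interface.jump γi γo =ᵐ[Interface.surfaceMeasure S] 0 ∧
      Interface.jump ηi ηo =ᵐ[Interface.surfaceMeasure S] 0) := by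
  open Interface in
  obtain ⟨n, rfl⟩ := Nat.exists_eq_add_of_le' hd
  have hloc := hS.locallyIntegrable_glue hγi hγo
  have hjγ : LocallyIntegrable (jump γi γo) (surfaceMeasure S) := hγo.1.sub hγi.1
  have hjη : LocallyIntegrable (jump ηi ηo) (surfaceMeasure S) := hηo.1.sub hηi.1
  have hsmooth : ∀ ψ : Euc (n + 1) → ℝ, ContDiff ℝ ∞ ψ → HasCompactSupport ψ →
      ∫ x, Laplacian.laplacian ψ x * glue Ωi Ωo φi φo x =
        (∫ x, jump ηi ηo x * ψ x ∂surfaceMeasure S) -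
          ∫ x, jump γi γo x * inner ℝ (∇ ψ x) (ν x) ∂surfaceMeasure S := fun ψ h1 h2 =>
    hS.integral_laplacian_mul_glue hΔi hΔo hγi hγo hηi hηo (h1.of_le ENat.LEInfty.out) h2
  have hweak : ∀ ψ : 𝓓((⊤ : Opens (Euc (n + 1))), ℝ),
      distLaplacian (distOfFun ⊤ (glue Ωi Ωo φi φo)) ψ =
        (∫ x, jump ηi ηo x * ψ x ∂surfaceMeasure S) -
          ∫ x, jump γi γo x * inner ℝ (∇ (ψ : Euc (n + 1) → ℝ) x) (ν x) ∂surfaceMeasure S :=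
    fun ψ => by
      rw [distLaplacian_distOfFun_apply (hloc.locallyIntegrableOn _)]
      exact hsmooth ψ ψ.contDiff ψ.hasCompactSupport
  refine ⟨hloc, hweak, ?_, ?_, ?_⟩
  · ext ψ
    rw [hweak ψ, add_apply, hS.doubleLayer_apply hjγ, singleLayer,
      distOfDensity_top_apply hjη, sub_eq_add_neg]
    simp only [mul_comm (ψ _)]
  · rintro ⟨H, hH, hHae⟩
    refine hS.ae_eq_zero_of_layers hjγ hjη fun ψ h1 h2 => sub_eq_zero.1 ?_
    rw [← hsmooth ψ h1 h2,
      ← integral_laplacian_mul_eq_zero_of_harmonic hH (h1.of_le ENat.LEInfty.out) h2]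
    exact integral_congr_ae (hHae.mono fun x hx => by simp only [hx])
  · rintro ⟨h1, h2⟩
    refine isGloballyHarmonic_of_integral_laplacian_eq_zero hloc fun χ hχ hc => ?_
    rw [hsmooth χ hχ hc, integral_eq_zero_of_ae (h2.mono fun x hx => by simp [hx]),
      integral_eq_zero_of_ae (h1.mono fun x hx => by simp [hx]), sub_zero]
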